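/- For a prime $p$ and an integer $a$ with $1 \le a \le p-1$ let $q_p(a) = \frac{a^{p-1}-1}{p}$ be the Fermat quotient, and for $n \ge 1$ let $Q_p(n) = \sum_{a=1}^{p-1} q_p(a)^n$. Let $B_k$ denote the Bernoulli numbers, defined by $\frac{t}{e^t-1} = \sum_{k \ge 0} B_k \frac{t^k}{k!}$. For a prime $p \ge 7$ and $n \ge 1$ put \[ \overline{B}_n = \frac{B_{n(p-1)} + \frac{1}{p} - 1}{n(p-1)}, \qquad \overline{B}_{n,d} = \frac{B_{n(p-1)-d}}{n(p-1)-d} \quad (d \in \{2,4\}). \] For rational numbers $x, y$, the congruence $x \equiv y \pmod{p^r}$ means that $x$ and $y$ are $p$-integral (their reduced denominators are prime to $p$) and $x - y$ is $p^r$ times a $p$-integral rational number. **Theorem.** Let $p$ be a prime. Of the following congruences, those modulo $p^5$ hold whenever $p \ge 7$, and those modulo $p^6$ hold whenever $p \ge 11$ (in each chain, the second right-hand side is congruent to the left-hand side modulo $p^5$ for every $p \ge 7$): \begin{align*} Q_p(1) &\equiv (p-1) \overline{B}_1 - p^2 \, \overline{B}_{1,2} + \tfrac{11}{6} p^3 \,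 \overline{B}_{1,2} - p^4 (\overline{B}_{1,2} + \overline{B}_{1,4}) \\ &\quad + p^5 (\tfrac{1}{6} \overline{B}_{1,2} + \tfrac{137}{60} \overline{B}_{1,4}) \pmod{p^6} \\ &\equiv (p-1) \overline{B}_1 - p^2 \, \overline{B}_{1,2} + \tfrac{11}{6} p^3 \, \overline{B}_{1,2} - p^4 (\overline{B}_{1,2} + \overline{B}_{1,4}) \pmod{p^5}, \\ \tfrac{1}{2} p \, Q_p(2) &\equiv (p-1) (\overline{B}_2 - \overline{B}_1) + p^2 (\overline{B}_{1,2} - 2 \overline{B}_{2,2}) + p^3 (-\tfrac{11}{6} \overline{B}_{1,2} + \tfrac{13}{3} \overline{B}_{2,2}) \\ &\quad + p^4 (\overline{B}_{1,2} - 3 \overline{B}_{2,2} + \overline{B}_{1,4} - 3 \overline{B}_{2,4}) + p^5 (\tfrac{1}{2} \overline{B}_{1,2} + \tfrac{77}{12} \overline{B}_{1,4}) \pmod{p^6} \\ &\equiv (p-1) (\overline{B}_2 - \overline{B}_1) + p^2 (\overline{B}_{1,2} - 2 \overline{B}_{2,2}) \\ &\quad + p^3 (-\tfrac{11}{6} \overline{B}_{1,2}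 + \tfrac{13}{3} \overline{B}_{2,2}) - p^4 (2 \overline{B}_{1,2} + 2 \overline{B}_{1,4}) \pmod{p^5}, \\ \tfrac{1}{3} p^2 \, Q_p(3) &\equiv (p-1) (\overline{B}_3 - 2 \overline{B}_2 + \overline{B}_1) \\ &\quad + p^2 (-\overline{B}_{1,2} + 4 \overline{B}_{2,2} - \tfrac{10}{3} \overline{B}_{3,2}) + p^3 (\tfrac{11}{6} \overline{B}_{1,2} - \tfrac{26}{3} \overline{B}_{2,2} + \tfrac{47}{6} \overline{B}_{3,2}) \\ &\quad + p^4 (5 \overline{B}_{1,2} - 6 \overline{B}_{2,2} + 6 \overline{B}_{1,4} - 8 \overline{B}_{2,4}) + p^5 (\tfrac{1}{3} \overline{B}_{1,2} + \tfrac{47}{6} \overline{B}_{1,4}) \pmod{p^6} \\ &\equiv (p-1) (\overline{B}_3 - 2 \overline{B}_2 + \overline{B}_1) + p^2 (-\overline{B}_{1,2} + 4 \overline{B}_{2,2} - \tfrac{10}{3} \overline{B}_{3,2}) \\ &\quad + p^3 (-6 \overline{B}_{1,2} + 7 \overline{B}_{2,2}) - p^4 (\overline{B}_{1,2} + 2 \overline{B}_{1,4})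 \pmod{p^5}, \\ \tfrac{1}{4} p^3 \, Q_p(4) &\equiv (p-1) (\overline{B}_4 - 3 \overline{B}_3 + 3 \overline{B}_2 - \overline{B}_1) \\ &\quad + p^2 (\overline{B}_{1,2} - 6 \overline{B}_{2,2} + 10 \overline{B}_{3,2} - 5 \overline{B}_{4,2}) + p^3 (\tfrac{21}{2} \overline{B}_{1,2} - 24 \overline{B}_{2,2} + \tfrac{27}{2} \overline{B}_{3,2}) \\ &\quad + p^4 (3 \overline{B}_{1,2} - 3 \overline{B}_{2,2} + 8 \overline{B}_{1,4} - 9 \overline{B}_{2,4}) + \tfrac{9}{2} p^5 \overline{B}_{1,4} \pmod{p^6} \\ &\equiv (p-1) (\overline{B}_4 - 3 \overline{B}_3 + 3 \overline{B}_2 - \overline{B}_1) + p^2 (-4 \overline{B}_{1,2} + 9 \overline{B}_{2,2} - 5 \overline{B}_{3,2}) \\ &\quad + p^3 (-3 \overline{B}_{1,2} + 3 \overline{B}_{2,2}) - p^4 \overline{B}_{1,4} \pmod{p^5}, \\ \tfrac{1}{5} p^4 \, Q_p(5) &\equiv (p-1) (\overline{B}_5 - 4 \overline{B}_4 + 6 \overline{B}_3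 - 4 \overline{B}_2 + \overline{B}_1) \\ &\quad + p^2 (6 \overline{B}_{1,2} - 20 \overline{B}_{2,2} + 22 \overline{B}_{3,2} - 8 \overline{B}_{4,2}) + p^3 (6 \overline{B}_{1,2} - 12 \overline{B}_{2,2} + 6 \overline{B}_{3,2}) \\ &\quad + p^4 (\tfrac{23}{5} \overline{B}_{1,4} - \tfrac{24}{5} \overline{B}_{2,4}) + p^5 \overline{B}_{1,4} \pmod{p^6} \\ &\equiv -(\overline{B}_5 - 4 \overline{B}_4 + 6 \overline{B}_3 - 4 \overline{B}_2 + \overline{B}_1) \\ &\quad + p^2 (-2 \overline{B}_{1,2} + 4 \overline{B}_{2,2} - 2 \overline{B}_{3,2}) - \tfrac{1}{5} p^4 \overline{B}_{1,4} \pmod{p^5}, \\ \tfrac{1}{6} p^5 \, Q_p(6) &\equiv -(\overline{B}_6 - 5 \overline{B}_5 + 10 \overline{B}_4 - 10 \overline{B}_3 + 5 \overline{B}_2 - \overline{B}_1) \\ &\quad + p^2 (\tfrac{10}{3} \overline{B}_{1,2} - 10 \overline{B}_{2,2} + 10 \overline{B}_{3,2} - \tfrac{10}{3} \overline{B}_{4,2})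 + p^4 (\overline{B}_{1,4} - \overline{B}_{2,4}) \pmod{p^6}. \end{align*} -/

import Mathlib

namespace FermatQuot

/-- A rational number is `p`-integral if `p` does not divide its reduced denominator. -/
def PIntegral (p : ℕ) (x : ℚ) : Prop := ¬ p ∣ x.den

/-- Congruence `x ≡ y (mod p ^ r)` between `p`-integral rational numbers: both sides are
`p`-integral and their difference is `p ^ r` times a `p`-integral number. -/
def CongrMod (p r : ℕ) (x y : ℚ) : Prop :=
  PIntegral p x ∧ PIntegral p y ∧ ∃ z : ℚ, PIntegral p z ∧ x - y = (p : ℚ) ^ r * z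

/-- The Fermat quotient `q_p(a) = (a ^ (p - 1) - 1) / p`. -/
def fermatQuotient (p a : ℕ) : ℚ := ((a : ℚ) ^ (p - 1) - 1) / p

/-- The power sum `Q_p(n)` of the Fermat quotients, over `1 ≤ a ≤ p - 1`. -/
def powerSum (p n : ℕ) : ℚ := ∑ a ∈ Finset.Icc 1 (p - 1), fermatQuotient p a ^ n

/-- The divided Bernoulli number
`(B_{n (p - 1)} + 1 / p - 1) / (n (p - 1))`. -/
def Bbar (p n : ℕ) : ℚ :=
  (bernoulli (n * (p - 1)) + 1 / (p : ℚ) - 1) / ((n : ℚ) * ((p : ℚ) - 1))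

/-- The divided Bernoulli number `B_{n (p - 1) - d} / (n (p - 1) - d)`. It is used only for
`d = 2, 4`, `n ≥ 1` and `p ≥ 7`, where `n (p - 1) > d`. -/
def BbarSub (p n d : ℕ) : ℚ :=
  bernoulli (n * (p - 1) - d) / ((n : ℚ) * ((p : ℚ) - 1) - (d : ℚ))

end FermatQuot

namespace FermatQuot

/-! Since p·q_p(a) = a^(p-1) - 1, the binomial theorem writes p^n·Q_p(n) as an alternating sum,
weighted by C(n,ν), of the power sums S_m over 1 ≤ a ≤ p-1 with m = ν(p-1)
(`prime_pow_mul_powerSum`). Faulhaber's formula expands S_m/p in powers of p. Odd Bernoulli numbers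
and the von Staudt–Clausen denominator bounds eliminate everything to the required precision except
B_m, B_(m-2), B_(m-4) (`divPow_sum_range_pow_six`, `divPow_sum_range_pow_five`). As C(n,ν)·ν/n =
C(n-1,ν-1), division by n·p turns the B_m part into p-1 times the (n-1)-st difference of the numbers
`Bbar`.

The B_(m-2) and B_(m-4) parts are reshaped by Kummer's congruences: B_k/k along k = ν(p-1)-d is, to
finite p-adic precision, a Newton series in ν-1 whose r-th coefficient is divisible by p^r
(`exists_bbarSub_eq`). High values of ν may therefore be traded for low ones. Kummer's congruences
come from Voronoi's congruence modulo a high power of p, taken with a multiplier close to a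
Teichmüller representative (`exists_newton_bernoulli_div`).

After these substitutions every claim is a polynomial identity in p, the Newton coefficients and the
error terms, all in the ring of p-integral rationals. -/

/-- `x` is `p ^ r` times a `p`-integral rational number (`r` may be negative). -/
def DivPow (p : ℕ) (r : ℤ) (x : ℚ) : Prop := padicNorm p x ≤ (p : ℚ) ^ (-r)

theorem DivPow.neg {p : ℕ} {r : ℤ} {x : ℚ} (hx : DivPow p r x) : DivPow p r (-x) := by
  unfold DivPow; rwa [padicNorm.neg]

theorem divPow_zero {p : ℕ} (r : ℤ) : DivPow p r 0 := by
  unfold DivPow; rw [padicNorm.zero]; positivity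

/-! ### Calculus of p-adic divisibility for rational numbers -/

section DivPow

variable {p : ℕ} [hp : Fact p.Prime] {r s : ℤ} {x y : ℚ}

theorem DivPow.mono (h : DivPow p r x) (hs : s ≤ r) : DivPow p s x :=
  h.trans (zpow_le_zpow_right₀ (by exact_mod_cast hp.out.one_le) (by lia))

theorem DivPow.add (hx : DivPow p r x) (hy : DivPow p r y) : DivPow p r (x + y) :=
  padicNorm.nonarchimedean.trans (max_le hx hy)

theorem DivPow.sub (hx : DivPow p r x) (hy : DivPow p r y) : DivPow p r (x - y) :=
  padicNorm.sub.trans (max_le hx hy)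

theorem DivPow.mul (hx : DivPow p r x) (hy : DivPow p s y) : DivPow p (r + s) (x * y) := by
  have h0 : (p : ℚ) ≠ 0 := by exact_mod_cast hp.out.ne_zero
  unfold DivPow at *
  rw [padicNorm.mul, neg_add, zpow_add₀ h0]
  exact mul_le_mul hx hy (padicNorm.nonneg _) (by positivity)

theorem DivPow.sum {ι : Type*} {t : Finset ι} {f : ι → ℚ} (h : ∀ i ∈ t, DivPow p r (f i)) :
    DivPow p r (∑ i ∈ t, f i) := by
  classical
  induction t using Finset.induction_on with
  | empty => simpa using divPow_zero r
  | insert a t ha ih =>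
    rw [Finset.sum_insert ha]
    exact (h a (by simp)).add (ih fun i hi => h i (by simp [hi]))

theorem divPow_intCast (n : ℤ) : DivPow p 0 n := by
  simpa [DivPow] using padicNorm.of_int n

theorem divPow_natCast (n : ℕ) : DivPow p 0 n := by
  simpa using divPow_intCast (p := p) n

theorem divPow_intCast_iff (n : ℤ) (k : ℕ) : DivPow p k n ↔ (p : ℤ) ^ k ∣ n := by
  unfold DivPow; rw [← padicNorm.dvd_iff_norm_le]; push_cast; rfl

theorem divPow_natCast_iff (n : ℕ) (k : ℕ) : DivPow p k n ↔ p ^ k ∣ n := by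
  have := divPow_intCast_iff (p := p) n k
  rw [Int.cast_natCast] at this
  rw [this]; exact_mod_cast Iff.rfl

theorem divPow_prime_pow (k : ℕ) : DivPow p k ((p : ℚ) ^ k) := by
  have := (divPow_natCast_iff (p := p) (p ^ k) k).2 dvd_rfl
  simpa using this

theorem divPow_prime_zpow (r : ℤ) : DivPow p r ((p : ℚ) ^ r) := by
  unfold DivPow
  rw [← Rat.cast_le (K := ℝ), ← Padic.eq_padicNorm]
  simp

theorem DivPow.pow_mul (k : ℕ) (hx : DivPow p 0 x) : DivPow p k ((p : ℚ) ^ k * x) := by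
  simpa using (divPow_prime_pow k).mul hx

/-- A factor that is a `p`-adic unit can be cancelled. -/
theorem DivPow.of_unit_mul {u : ℤ} (hu : ¬ (p : ℤ) ∣ u) (h : DivPow p r (u * x)) :
    DivPow p r x := by
  unfold DivPow at *
  rwa [padicNorm.mul, (padicNorm.int_eq_one_iff u).2 hu, one_mul] at h

theorem divPow_inv_of_lt {n e : ℕ} (hn : n ≠ 0) (h : n < p ^ (e + 1)) :
    DivPow p (-e : ℤ) ((n : ℚ)⁻¹) := by
  have hv : padicValNat p n ≤ e := by
    by_contra! hlt
    exact absurd (Nat.le_of_dvd (Nat.pos_of_ne_zero hn)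
      ((pow_dvd_pow p hlt).trans pow_padicValNat_dvd)) (by simpa using h)
  unfold DivPow
  rw [padicNorm.eq_zpow_of_nonzero (by simpa using hn), padicValRat.inv, padicValRat.of_nat]
  exact zpow_le_zpow_right₀ (by exact_mod_cast hp.out.one_le) (by simpa using hv)

theorem divPow_zero_iff : DivPow p 0 x ↔ PIntegral p x := by
  have hx : padicNorm p x = padicNorm p x.num / padicNorm p x.den := by
    rw [← padicNorm.div, Rat.num_div_den]
  unfold DivPow PIntegral
  rw [neg_zero, zpow_zero, hx]
  constructor
  · intro h hd
    have h1 : padicNorm p x.den < 1 := (padicNorm.nat_lt_one_iff _).2 hd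
    have h2 : 0 < padicNorm p x.den :=
      lt_of_le_of_ne (padicNorm.nonneg _) (padicNorm.nonzero (by simp)).symm
    have h3 : padicNorm p x.num = 1 := by
      rw [padicNorm.int_eq_one_iff]
      intro hn
      have := Nat.dvd_gcd (Int.natCast_dvd.1 hn) hd
      rw [x.reduced] at this
      exact hp.out.one_lt.ne' (Nat.dvd_one.1 this)
    rw [h3, div_le_one h2] at h
    exact absurd h (not_le.2 h1)
  · intro hd
    rw [(padicNorm.nat_eq_one_iff _).2 hd, div_one]
    exact padicNorm.of_int _

theorem DivPow.exists_eq (k : ℕ) (h : DivPow p k x) : ∃ z, DivPow p 0 z ∧ x = (p : ℚ) ^ k * z := by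
  have h0 : (p : ℚ) ≠ 0 := by exact_mod_cast hp.out.ne_zero
  refine ⟨(p : ℚ) ^ (-k : ℤ) * x, ?_, ?_⟩
  · simpa using (divPow_prime_zpow (p := p) (-k)).mul h
  · rw [zpow_neg, zpow_natCast, mul_inv_cancel_left₀ (pow_ne_zero _ h0)]

/-- A congruence follows from the divisibility of the difference and integrality of one side. -/
theorem congrMod_of_divPow {k : ℕ} (hx : DivPow p 0 x) (h : DivPow p k (x - y)) :
    CongrMod p k x y := by
  refine ⟨divPow_zero_iff.1 hx, divPow_zero_iff.1 ?_, ?_⟩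
  · simpa using hx.sub (h.mono (by positivity : (0 : ℤ) ≤ k))
  · obtain ⟨z, hz, e⟩ := h.exists_eq
    exact ⟨z, divPow_zero_iff.1 hz, e⟩

variable (p) in
/-- The ring of `p`-integral rational numbers. -/
def integralSubring : Subring ℚ where
  carrier := {x | DivPow p 0 x}
  zero_mem' := divPow_zero 0
  one_mem' := by simpa using divPow_natCast (p := p) 1
  add_mem' hx hy := hx.add hy
  neg_mem' hx := hx.neg
  mul_mem' {x y} hx hy := by simpa using DivPow.mul (p := p) (r := 0) (s := 0) hx hy

theorem integralSubring_coe_ofNat (n : ℕ) [n.AtLeastTwo] :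
    ((ofNat(n) : integralSubring p) : ℚ) = ofNat(n) := rfl

/-- Turns a divisibility bound into an equation with an error term in a ring. Integrality of a
polynomial witness is then automatic, and a congruence reduces to a ring identity. -/
theorem DivPow.exists_integralSubring (k : ℕ) (h : DivPow p k x) :
    ∃ z : integralSubring p, x = (p : ℚ) ^ k * z :=
  let ⟨z, hz, e⟩ := h.exists_eq
  ⟨⟨z, hz⟩, e⟩

end DivPow

/-! ### Denominators of Bernoulli numbers -/

section Bernoulli

variable {p : ℕ} [hp : Fact p.Prime]

theorem divPow_inv_natCast {n : ℕ} (h : ¬ p ∣ n) : DivPow p 0 ((n : ℚ)⁻¹) := by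
  have hn : (n : ℚ) ≠ 0 := by
    rintro h0
    exact h (by simp [Nat.cast_eq_zero.1 h0])
  refine DivPow.of_unit_mul (u := n) (by exact_mod_cast h) ?_
  rw [Int.cast_natCast, mul_inv_cancel₀ hn]
  simpa using divPow_natCast (p := p) 1

theorem divPow_inv_prime {q : ℕ} (hq : q.Prime) : DivPow p (-1) ((q : ℚ)⁻¹) := by
  by_cases h : p = q
  · subst h
    simpa using divPow_prime_zpow (p := p) (-1)
  · exact (divPow_inv_natCast (fun hd => h ((Nat.prime_dvd_prime_iff_eq hp.out hq).1 hd))).mono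
      (by norm_num)

/-- The only nonzero Bernoulli number of odd index is B_1 = -1/2, and 2 is a unit at an odd prime.
-/
theorem divPow_bernoulli_of_odd (h2 : p ≠ 2) {k : ℕ} (hk : Odd k) :
    DivPow p 0 (bernoulli k) := by
  by_cases h1 : k = 1
  · subst h1
    have : bernoulli 1 = -((2 : ℕ) : ℚ)⁻¹ := by rw [bernoulli_one]; norm_num
    rw [this]
    exact (divPow_inv_natCast
      (fun hd => h2 ((Nat.prime_dvd_prime_iff_eq hp.out Nat.prime_two).1 hd))).neg
  · rw [bernoulli_eq_zero_of_odd hk (by have := hk.pos; lia)]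
    exact divPow_zero 0

/-- The product of `p` and a Bernoulli number is `p`-integral. -/
theorem divPow_bernoulli (h2 : p ≠ 2) (k : ℕ) : DivPow p (-1) (bernoulli k) := by
  rcases Nat.even_or_odd' k with ⟨l, rfl | rfl⟩
  · obtain ⟨z, hz⟩ := Bernoulli.vonStaudt_clausen l
    rw [← sub_eq_iff_eq_add.2 hz]
    refine ((divPow_intCast z).mono (by norm_num)).sub (DivPow.sum fun q hq => ?_)
    rw [one_div]
    exact divPow_inv_prime (Finset.mem_filter.1 hq).2.1
  · exact (divPow_bernoulli_of_odd h2 (by simp)).mono (by norm_num)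

/-- Bernoulli numbers whose index is not divisible by `p - 1` are `p`-integral. -/
theorem divPow_bernoulli_of_not_dvd (h2 : p ≠ 2) {k : ℕ} (hk : ¬ p - 1 ∣ k) :
    DivPow p 0 (bernoulli k) := by
  rcases Nat.even_or_odd' k with ⟨l, rfl | rfl⟩
  · obtain ⟨z, hz⟩ := Bernoulli.vonStaudt_clausen l
    rw [← sub_eq_iff_eq_add.2 hz]
    refine (divPow_intCast z).sub (DivPow.sum fun q hq => ?_)
    have hq := (Finset.mem_filter.1 hq).2
    rw [one_div]
    -- Each prime q in the von Staudt–Clausen sum has q - 1 dividing the index, so q = p is excluded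
    -- by `hk`.
    refine divPow_inv_natCast fun hd => hk ?_
    rw [(Nat.prime_dvd_prime_iff_eq hp.out hq.1).1 hd]
    exact hq.2
  · exact divPow_bernoulli_of_odd h2 (by simp)

end Bernoulli

/-! ### Faulhaber's formula and its truncation -/

/-- Faulhaber's formula divided by the number of terms, by ascending powers of that number. -/
theorem sum_range_pow_div (N m : ℕ) (hN : N ≠ 0) :
    (∑ a ∈ Finset.range N, (a : ℚ) ^ m) / N =
      ∑ j ∈ Finset.range (m + 1), (m.choose j : ℚ) * bernoulli (m - j) * (N : ℚ) ^ j / (j + 1) := by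
  have hN' : (N : ℚ) ≠ 0 := by exact_mod_cast hN
  rw [sum_range_pow, ← Finset.sum_range_reflect, Finset.sum_div]
  refine Finset.sum_congr rfl fun j hj => ?_
  have hj : j ≤ m := by simpa [Nat.lt_succ_iff] using hj
  have e1 : m + 1 - 1 - j = m - j := by lia
  have e2 : m + 1 - (m - j) = j + 1 := by lia
  have e3 : (m + 1).choose (m - j) = (m + 1).choose (j + 1) := by
    rw [← Nat.choose_symm (by lia : m - j ≤ m + 1), e2]
  have e4 : ((m + 1 : ℕ) : ℚ) * m.choose j = (m + 1).choose (j + 1) * (j + 1 : ℕ) := by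
    exact_mod_cast Nat.add_one_mul_choose_eq m j
  rw [e1, e2, e3]
  have h1 : (m + 1 : ℚ) ≠ 0 := by positivity
  have h2 : (j + 1 : ℚ) ≠ 0 := by positivity
  push_cast at e4
  field_simp
  linear_combination (-bernoulli (m - j) * (N : ℚ) ^ (j + 1)) * e4

/-- Controls the denominators in Faulhaber's formula: with b = p it gives v_p(j+1) < j, so p^j/(j+1)
keeps a factor p. -/
theorem succ_lt_pow {b : ℕ} (hb : 3 ≤ b) (j : ℕ) (hj : 1 ≤ j) : j + 1 < b ^ j := by
  induction j, hj using Nat.le_induction with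
  | base => simpa using by lia
  | succ j hj ih => rw [pow_succ]; nlinarith

/-- Truncation of Faulhaber's formula, with the three terms of lowest order kept. -/
theorem sum_range_pow_div_eq {p : ℕ} (h7 : 7 ≤ p) {m : ℕ} (hm : 6 ≤ m) (he : Even m) :
    (∑ a ∈ Finset.range p, (a : ℚ) ^ m) / p -
      (bernoulli m + m.choose 2 * bernoulli (m - 2) * (p : ℚ) ^ 2 / 3
        + m.choose 4 * bernoulli (m - 4) * (p : ℚ) ^ 4 / 5) =
      m.choose 5 * bernoulli (m - 5) * (p : ℚ) ^ 5 / (5 + 1)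
        + m.choose 6 * bernoulli (m - 6) * (p : ℚ) ^ 6 / (6 + 1)
        + ∑ i ∈ Finset.range (m - 6), (m.choose (7 + i) : ℚ) * bernoulli (m - (7 + i)) *
            (p : ℚ) ^ (7 + i) / ((7 + i : ℕ) + 1) := by
  -- The strict bound excludes j = 5 when m = 6 (the case p = 7, ν = 1), where B_1 is not zero.
  -- Hence the j = 5 term survives in the remainder.
  have hodd (j : ℕ) (hj : Odd j) (h : j + 1 < m) : bernoulli (m - j) = 0 :=
    bernoulli_eq_zero_of_odd (Nat.Even.sub_odd (by lia) he hj) (by lia)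
  have e : m + 1 = 7 + (m - 6) := by lia
  rw [sum_range_pow_div p m (by lia), e, Finset.sum_range_add]
  simp only [Finset.sum_range_succ, Finset.sum_range_zero]
  rw [hodd 1 (by decide) (by lia), hodd 3 (by decide) (by lia)]
  norm_num
  ring

theorem not_dvd_sub {p m j : ℕ} (hd : p - 1 ∣ m) (hj : j ≠ 0) (hjp : j < p - 1) (hjm : j ≤ m) :
    ¬ p - 1 ∣ m - j := fun h =>
  absurd (Nat.le_of_dvd (Nat.pos_of_ne_zero hj) ((Nat.dvd_sub_iff_right hjm hd).1 h)) (not_le.2 hjp)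

section Tails

variable {p : ℕ} [hp : Fact p.Prime]

/-- `p`-adic size of a term of `sum_range_pow_div`. -/
theorem divPow_faulhaber_term {c : ℤ} (s m j e : ℕ) (hb : DivPow p c (bernoulli (m - j)))
    (he : j + 1 < p ^ (e + 1)) :
    DivPow p (c + s * j - e)
      ((m.choose j : ℚ) * bernoulli (m - j) * ((p ^ s : ℕ) : ℚ) ^ j / (j + 1)) := by
  have h1 := ((divPow_natCast (p := p) (m.choose j)).mul hb).mul
    (divPow_prime_pow (p := p) (s * j))
  have h2 := h1.mul (divPow_inv_of_lt (p := p) (n := j + 1) (by lia) he)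
  convert h2 using 1
  · push_cast; ring
  · push_cast
    rw [pow_mul, div_eq_mul_inv]

/-- The normalized power sum over `range (p ^ s)` approximates the Bernoulli number. -/
theorem divPow_sum_range_pow_div_sub (h2 : p ≠ 2) {s : ℕ} (hs : 1 ≤ s) (m : ℕ) :
    DivPow p (s - 1)
      ((∑ a ∈ Finset.range (p ^ s), (a : ℚ) ^ m) / (p ^ s : ℕ) - bernoulli m) := by
  have h3 : 3 ≤ p := by have := hp.out.two_le; lia
  rw [sum_range_pow_div _ _ (pow_ne_zero _ hp.out.ne_zero), Finset.sum_range_succ']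
  simp only [Nat.choose_zero_right, Nat.cast_one, one_mul, Nat.sub_zero, pow_zero, mul_one,
    Nat.cast_zero, zero_add, div_one, add_sub_cancel_right]
  refine DivPow.sum fun j _ => ?_
  have hlt : (j + 1) + 1 < p ^ (j + 1) := succ_lt_pow h3 _ (by lia)
  refine (divPow_faulhaber_term (c := -1) s m (j + 1) j (divPow_bernoulli h2 _) hlt).mono ?_
  -- The size of term j + 1 is -1 + s(j+1) - j, which exceeds s - 1 by (s-1)j ≥ 0.
  push_cast
  have : 1 ≤ (s : ℤ) := by exact_mod_cast hs
  nlinarith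

/-- The terms of index `≥ 7` in `sum_range_pow_div`. -/
theorem divPow_faulhaber_tail (h2 : p ≠ 2) (t m n : ℕ) (h : ∀ i, 7 + i + 1 < p ^ (i + t + 1)) :
    DivPow p (6 - t) (∑ i ∈ Finset.range n,
      (m.choose (7 + i) : ℚ) * bernoulli (m - (7 + i)) * (p : ℚ) ^ (7 + i) / ((7 + i : ℕ) + 1)) := by
  -- Term 7 + i has size at least -1 + (7+i) - (i+t) = 6 - t. The slack `t` is 0 when p > 8 and 1
  -- for p = 7, whose square bounds the denominator 8.
  refine DivPow.sum fun i _ => ?_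
  have := divPow_faulhaber_term (c := -1) 1 m (7 + i) (i + t) (divPow_bernoulli h2 _) (h i)
  rw [pow_one] at this
  refine this.mono ?_
  push_cast
  lia

/-- For p ≥ 11 the j = 5 term vanishes. The j = 6 term loses no power of p, because 6 < p - 1 makes
B_(m-6) integral and 7 is a unit. -/
theorem divPow_sum_range_pow_six (h11 : 11 ≤ p) {ν : ℕ} (hν : ν ≠ 0) :
    DivPow p 6 ((∑ a ∈ Finset.range p, (a : ℚ) ^ (ν * (p - 1))) / p -
      (bernoulli (ν * (p - 1))
        + (ν * (p - 1)).choose 2 * bernoulli (ν * (p - 1) - 2) * (p : ℚ) ^ 2 / 3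
        + (ν * (p - 1)).choose 4 * bernoulli (ν * (p - 1) - 4) * (p : ℚ) ^ 4 / 5)) := by
  have h2 : p ≠ 2 := by lia
  have hm : p - 1 ≤ ν * (p - 1) := Nat.le_mul_of_pos_left _ (Nat.pos_of_ne_zero hν)
  have he : Even (ν * (p - 1)) := (hp.out.even_sub_one h2).mul_left _
  have hd : p - 1 ∣ ν * (p - 1) := dvd_mul_left _ _
  generalize ν * (p - 1) = m at *
  rw [sum_range_pow_div_eq (by lia) (by lia) he,
    bernoulli_eq_zero_of_odd (n := m - 5) (Nat.Even.sub_odd (by lia) he (by decide)) (by lia)]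
  refine DivPow.add (DivPow.add (by simpa using divPow_zero 6) ?_) ?_
  · have := divPow_faulhaber_term 1 m 6 0 (divPow_bernoulli_of_not_dvd h2
      (not_dvd_sub hd (by lia) (by lia) (by lia) : ¬ p - 1 ∣ m - 6)) (by simp; lia)
    simpa using this
  · have := divPow_faulhaber_tail h2 0 m (m - 6) fun i => ?_
    · simpa using this
    · induction i with
      | zero => simp; lia
      | succ i ih => rw [show i + 1 + 0 + 1 = (i + 0 + 1) + 1 by ring, pow_succ]; nlinarith

/-- Only p = 7 is new. There the j = 6 term has denominator 7, and B_(m-6) may contribute another 7.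
The second loss is repaid by 7 ∣ C(6ν,6) for 2 ≤ ν ≤ 5, while ν = 1 gives B_0 = 1; this is why ν is
bounded. -/
theorem divPow_sum_range_pow_five (h7 : 7 ≤ p) {ν : ℕ} (hν : ν ≠ 0) (hν5 : ν ≤ 5) :
    DivPow p 5 ((∑ a ∈ Finset.range p, (a : ℚ) ^ (ν * (p - 1))) / p -
      (bernoulli (ν * (p - 1))
        + (ν * (p - 1)).choose 2 * bernoulli (ν * (p - 1) - 2) * (p : ℚ) ^ 2 / 3
        + (ν * (p - 1)).choose 4 * bernoulli (ν * (p - 1) - 4) * (p : ℚ) ^ 4 / 5)) := by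
  by_cases h11 : 11 ≤ p
  · exact (divPow_sum_range_pow_six h11 hν).mono (by norm_num)
  have hp7 : p = 7 := by
    have := hp.out
    have : p ≤ 10 := by lia
    interval_cases p
    · rfl
    all_goals revert this; norm_num at *
  have h2 : p ≠ 2 := by lia
  have hm : p - 1 ≤ ν * (p - 1) := Nat.le_mul_of_pos_left _ (Nat.pos_of_ne_zero hν)
  have he : Even (ν * (p - 1)) := (hp.out.even_sub_one h2).mul_left _
  have hd : p - 1 ∣ ν * (p - 1) := dvd_mul_left _ _
  have h6 : DivPow p 0 ((ν * (p - 1)).choose 6 * bernoulli (ν * (p - 1) - 6)) := by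
    by_cases h1 : ν = 1
    · subst h1 hp7
      simpa using divPow_natCast (p := 7) 1
    · have hc : p ^ 1 ∣ (ν * (p - 1)).choose 6 := by
        subst hp7
        interval_cases ν <;> first | contradiction | decide
      simpa using ((divPow_natCast_iff _ 1).2 hc).mul
        (divPow_bernoulli h2 (ν * (p - 1) - 6))
  generalize ν * (p - 1) = m at *
  rw [sum_range_pow_div_eq h7 (by lia) he]
  refine DivPow.add (DivPow.add ?_ ?_) ?_
  · have := divPow_faulhaber_term 1 m 5 0 (divPow_bernoulli_of_not_dvd h2
      (not_dvd_sub hd (by lia) (by lia) (by lia) : ¬ p - 1 ∣ m - 5)) (by simp; lia)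
    simpa using this
  · have := (h6.mul (divPow_prime_pow (p := p) 6)).mul
      (divPow_inv_of_lt (p := p) (n := 7) (e := 1) (by norm_num) (by rw [hp7]; norm_num))
    refine (?_ : DivPow p (0 + (6 : ℕ) + (-(1 : ℕ))) _).mono (by norm_num)
    convert this using 1
    push_cast
    ring
  · have := divPow_faulhaber_tail h2 1 m (m - 6) fun i => ?_
    · simpa using this
    · induction i with
      | zero => simp; nlinarith
      | succ i ih => rw [show i + 1 + 1 + 1 = (i + 1 + 1) + 1 by ring, pow_succ]; nlinarith

end Tails
-- Voronoi's congruence and power sums over units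
/-- Voronoi's congruence for a power sum over residues prime to `N`. -/
theorem exists_voronoi {N c k : ℕ} (hN : N ≠ 0) (hc : c.Coprime N) :
    ∃ z : ℤ, ((c : ℤ) ^ k - 1) * ∑ a ∈ Finset.range N with a.Coprime N, (a : ℤ) ^ k =
      k * N * ∑ a ∈ Finset.range N with a.Coprime N,
        ((c * a / N : ℕ) : ℤ) * ((c : ℤ) * a) ^ (k - 1) + (N : ℤ) ^ 2 * z := by
  set A := (Finset.range N).filter (fun a => a.Coprime N) with hA
  -- Multiplication by c permutes the residues prime to N. Writing ca mod N as ca - N⌊ca/N⌋ and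
  -- expanding the k-th power to first order in N gives the congruence.
  have hmaps : ∀ a ∈ A, c * a % N ∈ A := by
    intro a ha
    rw [hA, Finset.mem_filter, Finset.mem_range] at ha ⊢
    refine ⟨Nat.mod_lt _ (Nat.pos_of_ne_zero hN), ?_⟩
    have : (c * a).Coprime N := hc.mul_left ha.2
    rwa [Nat.Coprime, ← Nat.gcd_rec, Nat.gcd_comm]
  have hinj : Set.InjOn (fun a => c * a % N) A := by
    intro a ha b hb hab
    simp only [hA, Finset.coe_filter, Finset.mem_range, Set.mem_ofPred_eq] at ha hb
    have : a ≡ b [MOD N] := Nat.ModEq.cancel_left_of_coprime hc.symm hab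
    exact Nat.ModEq.eq_of_lt_of_lt this ha.1 hb.1
  have hperm : ∑ a ∈ A, ((c * a % N : ℕ) : ℤ) ^ k = ∑ a ∈ A, (a : ℤ) ^ k :=
    Finset.sum_nbij (fun a => c * a % N) hmaps hinj
      (Finset.surjOn_of_injOn_of_card_le _ hmaps hinj le_rfl) (fun _ _ => rfl)
  have hexp : ∀ a : ℕ, ∃ z : ℤ, ((c * a % N : ℕ) : ℤ) ^ k =
      ((c : ℤ) * a) ^ k - k * N * (((c * a / N : ℕ) : ℤ) * ((c : ℤ) * a) ^ (k - 1))
        + (N : ℤ) ^ 2 * z := by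
    intro a
    obtain ⟨z, hz⟩ := Polynomial.powAddExpansion ((c : ℤ) * a) (-(N * (c * a / N : ℕ))) k
    refine ⟨z * ((c * a / N : ℕ) : ℤ) ^ 2, ?_⟩
    have e : ((c * a % N : ℕ) : ℤ) = (c : ℤ) * a + -(N * (c * a / N : ℕ)) := by
      have := Nat.mod_add_div (c * a) N
      zify at this ⊢
      linear_combination this
    rw [e, hz]
    ring
  choose z hz using hexp
  refine ⟨-∑ a ∈ A, z a, ?_⟩
  rw [Finset.sum_congr rfl fun a _ => hz a, Finset.sum_add_distrib, Finset.sum_sub_distrib,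
    ← Finset.mul_sum, ← Finset.mul_sum] at hperm
  simp only [mul_pow] at hperm ⊢
  rw [← Finset.mul_sum] at hperm
  linear_combination hperm

/-- The residues removed are pb with b < p^s. After division by p^(s+1) they produce the Euler
factor 1 - p^(k-1). -/
theorem sum_coprime_prime_pow {p : ℕ} (hp : p.Prime) (s k : ℕ) :
    ∑ a ∈ Finset.range (p ^ (s + 1)) with a.Coprime (p ^ (s + 1)), (a : ℚ) ^ k =
      ∑ a ∈ Finset.range (p ^ (s + 1)), (a : ℚ) ^ k
        - (p : ℚ) ^ k * ∑ a ∈ Finset.range (p ^ s), (a : ℚ) ^ k := by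
  have e : ∑ a ∈ Finset.range (p ^ (s + 1)) with ¬ a.Coprime (p ^ (s + 1)), (a : ℚ) ^ k =
      (p : ℚ) ^ k * ∑ a ∈ Finset.range (p ^ s), (a : ℚ) ^ k := by
    rw [Finset.mul_sum]
    symm
    refine Finset.sum_nbij (fun a => p * a) ?_ ?_ ?_ ?_
    · intro a ha
      simp only [Finset.mem_filter, Finset.mem_range] at ha ⊢
      refine ⟨by rw [pow_succ']; exact Nat.mul_lt_mul_of_pos_left ha hp.pos, ?_⟩
      rw [Nat.coprime_pow_right_iff (by lia), Nat.coprime_comm, hp.coprime_iff_not_dvd, not_not]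
      exact dvd_mul_right _ _
    · intro a _ b _ hab
      exact Nat.eq_of_mul_eq_mul_left hp.pos hab
    · intro a ha
      simp only [Finset.coe_filter, Finset.mem_range, Set.mem_ofPred_eq] at ha
      rw [Nat.coprime_pow_right_iff (by lia), Nat.coprime_comm, hp.coprime_iff_not_dvd,
        not_not] at ha
      obtain ⟨h, b, rfl⟩ := ha
      refine ⟨b, ?_, rfl⟩
      rw [pow_succ'] at h
      simpa using Nat.lt_of_mul_lt_mul_left h
    · intro a _
      push_cast
      ring
  rw [← e, eq_sub_iff_add_eq, Finset.sum_filter_add_sum_filter_not]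

/-! ### Kummer's congruences as a Newton series -/

section Kummer

variable {p : ℕ} [hp : Fact p.Prime]

/-- A primitive root modulo `p` that is close to a Teichmüller representative. -/
theorem exists_primitive_root_pow_sub_one (M : ℕ) :
    ∃ c : ℕ, ¬ p ∣ c ∧ (p : ℤ) ^ M ∣ (c : ℤ) ^ (p - 1) - 1 ∧
      ∀ d, d ≠ 0 → d < p - 1 → ¬ (p : ℤ) ∣ (c : ℤ) ^ d - 1 := by
  obtain ⟨g, hg⟩ := IsCyclic.exists_generator (α := (ZMod p)ˣ)
  have hord : orderOf g = p - 1 := by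
    rw [orderOf_eq_card_of_forall_mem_zpowers hg, Nat.card_eq_fintype_card, ZMod.card_units]
  have hgv : (((g : ZMod p).val : ℕ) : ZMod p) = g := ZMod.natCast_zmod_val _
  have hpg : ¬ p ∣ (g : ZMod p).val := by
    rw [← ZMod.natCast_eq_zero_iff, hgv]
    exact g.ne_zero
  -- The exponent p^M(p-1) is φ(p^(M+1)), so the (p-1)-st power is 1 modulo p^(M+1). Raising to p^M
  -- fixes residues modulo p, so the order stays p - 1.
  refine ⟨(g : ZMod p).val ^ p ^ M, fun h => hpg (hp.out.dvd_of_dvd_pow h), ?_, ?_⟩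
  · have h := Nat.ModEq.pow_totient (n := p ^ (M + 1)) (x := (g : ZMod p).val)
      (((Nat.Prime.coprime_iff_not_dvd hp.out).2 hpg).symm.pow_right _)
    rw [Nat.totient_prime_pow_succ hp.out, pow_mul] at h
    have h' := (Nat.modEq_iff_dvd.1 h.symm)
    push_cast at h' ⊢
    exact (pow_dvd_pow _ (Nat.le_succ M)).trans h'
  · intro d hd hdp h
    have h1 : (((((g : ZMod p).val ^ p ^ M : ℕ) : ℤ) ^ d - 1 : ℤ) : ZMod p) = 0 :=
      (ZMod.intCast_zmod_eq_zero_iff_dvd _ _).2 h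
    push_cast at h1
    rw [hgv, ZMod.pow_card_pow, sub_eq_zero] at h1
    have h2 : g ^ d = 1 := Units.ext (by simpa using h1)
    have := Nat.le_of_dvd (Nat.pos_of_ne_zero hd) (orderOf_dvd_of_pow_eq_one h2)
    lia

/-- Power sums over residues prime to `p` approximate Bernoulli numbers without Euler factor. -/
theorem divPow_sum_coprime_sub (h2 : p ≠ 2) {s k : ℕ} (hs : 1 ≤ s) (hk : 1 ≤ k) :
    DivPow p (s - 1)
      ((∑ a ∈ Finset.range (p ^ (s + 1)) with a.Coprime (p ^ (s + 1)), (a : ℚ) ^ k)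
          / (p ^ (s + 1) : ℕ)
        - (1 - (p : ℚ) ^ (k - 1)) * bernoulli k) := by
  have h0 : (p : ℚ) ≠ 0 := by exact_mod_cast hp.out.ne_zero
  have h1 := (divPow_sum_range_pow_div_sub h2 (s := s + 1) (by lia) k).mono
    (by push_cast; lia : (s - 1 : ℤ) ≤ _)
  have h3 := (divPow_natCast (p := p) (p ^ (k - 1))).mul
    (divPow_sum_range_pow_div_sub h2 hs k)
  rw [zero_add] at h3
  convert h1.sub h3 using 1
  rw [sum_coprime_prime_pow hp.out]
  obtain ⟨l, rfl⟩ : ∃ l, k = l + 1 := ⟨k - 1, by lia⟩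
  push_cast
  field_simp
  ring

/-- **Kummer's congruences**: along the progression `k = ν (p - 1) - d`, the numbers
`(1 - p ^ (k - 1)) B_k / k` are given `p`-adically by a Newton series whose `r`-th coefficient is
divisible by `p ^ r`. -/
theorem exists_newton_bernoulli_div (h2 : p ≠ 2) {d : ℕ} (hd : d ≠ 0) (hdp : d ≤ p - 2) (M L : ℕ) :
    ∃ c : ℕ → ℚ, (∀ r, DivPow p 0 (c r)) ∧ ∀ n ≤ L, n * (p - 1) + (p - 1 - d) ≠ 0 →
      DivPow p M ((1 - (p : ℚ) ^ (n * (p - 1) + (p - 1 - d) - 1)) *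
          (bernoulli (n * (p - 1) + (p - 1 - d)) / (n * (p - 1) + (p - 1 - d) : ℕ))
        - ∑ r ∈ Finset.range (n + 1), (n.choose r : ℚ) * (p : ℚ) ^ r * c r) := by
  have hp2 := hp.out.two_le
  obtain ⟨g, hg, hgM, hgd⟩ := exists_primitive_root_pow_sub_one (p := p) (M + 1)
  -- K bounds every index k in play, so dividing by k costs at most p^K. The choice of s leaves
  -- precision s - 1 - K = M.
  set K := (L + 1) * (p - 1) with hK
  set s := M + K + 1 with hs
  set N := p ^ (s + 1) with hN
  have hN0 : N ≠ 0 := pow_ne_zero _ hp.out.ne_zero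
  set A := (Finset.range N).filter (fun a => a.Coprime N) with hA
  -- As p - 1 divides d + k, the Voronoi factor satisfies g^d(g^k - 1) ≡ u, independently of n. It
  -- is a unit because 0 < d < p - 1 and g is a primitive root.
  set u : ℤ := 1 - (g : ℤ) ^ d with hu
  have hu' : ¬ (p : ℤ) ∣ u := by
    have := hgd d hd (by lia)
    rwa [hu, ← dvd_neg, neg_sub]
  have hu0 : (u : ℚ) ≠ 0 := by
    intro h
    exact hu' (by rw [Int.cast_eq_zero.1 h]; exact dvd_zero _)
  have hgN : g.Coprime N := ((Nat.Prime.coprime_iff_not_dvd hp.out).2 hg).symm.pow_right _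
  have hy : ∀ a : ℕ, ∃ y : ℤ, a ∈ A → ((g : ℤ) * a) ^ (p - 1) = 1 + p * y := by
    intro a
    by_cases ha : a ∈ A
    · have hap : a.Coprime p :=
        (Nat.coprime_pow_right_iff (by lia) _ _).1 (Finset.mem_filter.1 ha).2
      have hc : IsCoprime ((g : ℤ) * a) p := by
        rw [← Nat.cast_mul, Nat.isCoprime_iff_coprime]
        exact ((Nat.Prime.coprime_iff_not_dvd hp.out).2 hg).symm.mul_left hap
      obtain ⟨y, hy⟩ := (Int.ModEq.pow_card_sub_one_eq_one hp.out hc).symm.dvd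
      exact ⟨y, fun _ => by linear_combination hy⟩
    · exact ⟨0, fun h => absurd h ha⟩
  choose y hy using hy
  -- From k - 1 = (p-1)n + (p-2-d), the power (ga)^(k-1) is (1 + p·y a)^n times a factor free of n,
  -- which `w` collects.
  set w : ℕ → ℤ := fun a => (g : ℤ) ^ d * (((g * a / N : ℕ) : ℤ) * ((g : ℤ) * a) ^ (p - 2 - d))
    with hw
  have hui : DivPow p 0 ((u : ℚ)⁻¹) := DivPow.of_unit_mul hu' (by
    rw [mul_inv_cancel₀ hu0]; simpa using divPow_natCast (p := p) 1)
  have hmain : ∀ n ≤ L, n * (p - 1) + (p - 1 - d) ≠ 0 →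
      DivPow p M ((1 - (p : ℚ) ^ (n * (p - 1) + (p - 1 - d) - 1)) *
          (bernoulli (n * (p - 1) + (p - 1 - d)) / (n * (p - 1) + (p - 1 - d) : ℕ))
        - (u : ℚ)⁻¹ * ((∑ a ∈ A, w a * (1 + p * y a) ^ n : ℤ) : ℚ)) := by
    intro n hn hk
    set k := n * (p - 1) + (p - 1 - d) with hkdef
    have hkK : k ≤ K := by
      have : n * (p - 1) ≤ L * (p - 1) := Nat.mul_le_mul_right _ hn
      rw [hK, add_mul]
      lia
    have hkQ : (k : ℚ) ≠ 0 := by exact_mod_cast hk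
    have hNQ : (N : ℚ) ≠ 0 := by exact_mod_cast hN0
    set β : ℚ := (1 - (p : ℚ) ^ (k - 1)) * (bernoulli k / k) with hβ
    obtain ⟨z, hz⟩ := exists_voronoi (k := k) hN0 hgN
    rw [← hA] at hz
    set V : ℤ := ∑ a ∈ A, ((g * a / N : ℕ) : ℤ) * ((g : ℤ) * a) ^ (k - 1) with hV
    set W : ℤ := ∑ a ∈ A, w a * (1 + p * y a) ^ n with hW
    have hWV : W = (g : ℤ) ^ d * V := by
      rw [hW, hV, Finset.mul_sum]
      refine Finset.sum_congr rfl fun a ha => ?_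
      rw [← hy a ha, hw, show k - 1 = (p - 1) * n + (p - 2 - d) by rw [hkdef, mul_comm]; lia,
        pow_add, pow_mul]
      ring
    have hS := divPow_sum_coprime_sub h2 (s := s) (k := k) (by lia) (Nat.pos_of_ne_zero hk)
    rw [← hN, ← hA] at hS
    have hzQ := congrArg (Int.cast : ℤ → ℚ) hz
    push_cast at hzQ
    have hE : DivPow p M (((g : ℚ) ^ k - 1) * β - V) := by
      have h1 := (divPow_intCast (p := p) ((g : ℤ) ^ k - 1)).mul hS
      rw [zero_add] at h1
      have h2 : DivPow p (s - 1) ((N : ℚ) * z) := by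
        rw [hN, Nat.cast_pow]
        exact ((divPow_intCast z).pow_mul (s + 1)).mono (by push_cast; lia)
      have h3 := (h2.sub h1).mul (divPow_inv_of_lt (p := p) (n := k) (e := K) hk
        (hkK.trans_lt ((Nat.lt_pow_self hp.out.one_lt).trans
          (Nat.pow_lt_pow_right hp.out.one_lt (Nat.lt_succ_self K)))))
      refine (?_ : DivPow p (s - 1 + -K) _).mono (by rw [hs]; push_cast; lia)
      convert h3 using 1
      rw [hβ]
      push_cast
      field_simp
      linear_combination hzQ
    obtain ⟨t, ht⟩ : ∃ t : ℤ, (g : ℤ) ^ d * ((g : ℤ) ^ k - 1) = u + p ^ (M + 1) * t := by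
      have h1 : (p : ℤ) ^ (M + 1) ∣ ((g : ℤ) ^ (p - 1)) ^ (n + 1) - 1 :=
        hgM.trans (by simpa using sub_dvd_pow_sub_pow ((g : ℤ) ^ (p - 1)) 1 (n + 1))
      obtain ⟨t, ht⟩ := h1
      refine ⟨t, ?_⟩
      have e : d + k = (p - 1) * (n + 1) := by rw [hkdef, mul_add, mul_comm]; lia
      rw [← pow_mul, ← e, pow_add] at ht
      rw [hu]
      linear_combination ht
    have hunit : ¬ (p : ℤ) ∣ u + p ^ (M + 1) * t := by
      rwa [Int.dvd_add_left]
      rw [pow_succ']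
      exact ⟨p ^ M * t, by ring⟩
    have htQ := congrArg (Int.cast : ℤ → ℚ) ht
    push_cast at htQ
    have hF : DivPow p M (((u + p ^ (M + 1) * t : ℤ) : ℚ) * β - W) := by
      have h1 := (divPow_intCast (p := p) ((g : ℤ) ^ d)).mul hE
      rw [zero_add] at h1
      convert h1 using 1
      rw [hWV]
      push_cast
      linear_combination (-β) * htQ
    -- A unit multiple of β lies within p^M of an integer, so β is integral. Only then can the term
    -- p^(M+1)·t·β be discarded.
    have hβ0 : DivPow p 0 β := by
      refine DivPow.of_unit_mul hunit ?_
      have := (hF.mono (by positivity : (0 : ℤ) ≤ M)).add (divPow_intCast W)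
      simpa using this
    have h1 := ((divPow_intCast (p := p) t).pow_mul (M + 1)).mul hβ0
    have h2 := hui.mul (hF.sub (h1.mono (by push_cast; lia)))
    rw [zero_add] at h2
    convert h2 using 1
    push_cast
    field_simp
    ring
  -- Expanding (1 + p·y a)^n binomially exhibits C(n,r)p^r times a coefficient that does not depend
  -- on n.
  refine ⟨fun r => (u : ℚ)⁻¹ * ((∑ a ∈ A, w a * y a ^ r : ℤ) : ℚ), fun r => by
    simpa using hui.mul (divPow_intCast (p := p) (∑ a ∈ A, w a * y a ^ r)), fun n hn hk => ?_⟩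
  convert hmain n hn hk using 2
  push_cast
  simp only [Finset.mul_sum]
  rw [Finset.sum_comm]
  refine Finset.sum_congr rfl fun a _ => ?_
  rw [add_comm (1 : ℚ), add_pow]
  simp only [Finset.mul_sum]
  refine Finset.sum_congr rfl fun r _ => ?_
  rw [mul_pow]
  ring

end Kummer

/-! ### Power sums of Fermat quotients in terms of divided Bernoulli numbers -/

section Expansion

variable {p : ℕ} [hp : Fact p.Prime]

theorem exists_fermatQuotient_eq {a : ℕ} (ha : a ∈ Finset.Icc 1 (p - 1)) :
    ∃ z : ℤ, fermatQuotient p a = z := by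
  have h0 : (p : ℚ) ≠ 0 := by exact_mod_cast hp.out.ne_zero
  rw [Finset.mem_Icc] at ha
  have hc : IsCoprime (a : ℤ) p := by
    rw [Nat.isCoprime_iff_coprime, Nat.coprime_comm, hp.out.coprime_iff_not_dvd]
    intro h
    have := Nat.le_of_dvd ha.1 h
    lia
  obtain ⟨z, hz⟩ := (Int.ModEq.pow_card_sub_one_eq_one hp.out hc).symm.dvd
  refine ⟨z, ?_⟩
  have hz' := congrArg (Int.cast : ℤ → ℚ) hz
  push_cast at hz'
  rw [fermatQuotient, hz', mul_div_cancel_left₀ _ h0]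

theorem exists_powerSum_eq (n : ℕ) : ∃ q : integralSubring p, powerSum p n = q := by
  have h : DivPow p 0 (powerSum p n) := by
    refine DivPow.sum fun a ha => ?_
    obtain ⟨z, hz⟩ := exists_fermatQuotient_eq ha
    rw [hz]
    simpa using divPow_intCast (p := p) (z ^ n)
  exact ⟨⟨_, h⟩, rfl⟩

/-- Binomial expansion of the power sums of Fermat quotients. -/
theorem prime_pow_mul_powerSum (n : ℕ) :
    (p : ℚ) ^ n * powerSum p n = ∑ ν ∈ Finset.range (n + 1), (-1) ^ (n - ν) * (n.choose ν : ℚ) *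
      ∑ a ∈ Finset.Icc 1 (p - 1), (a : ℚ) ^ (ν * (p - 1)) := by
  have h0 : (p : ℚ) ≠ 0 := by exact_mod_cast hp.out.ne_zero
  simp only [powerSum, Finset.mul_sum]
  rw [Finset.sum_comm]
  refine Finset.sum_congr rfl fun a _ => ?_
  rw [fermatQuotient, ← mul_pow, mul_div_cancel₀ _ h0, sub_eq_add_neg, add_pow]
  refine Finset.sum_congr rfl fun ν _ => ?_
  rw [← pow_mul, mul_comm (p - 1)]
  ring

theorem sum_Icc_pow_eq {m : ℕ} (hm : m ≠ 0) :
    ∑ a ∈ Finset.Icc 1 (p - 1), (a : ℚ) ^ m = ∑ a ∈ Finset.range p, (a : ℚ) ^ m := by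
  obtain ⟨q, hq⟩ : ∃ q, p = q + 1 := ⟨p - 1, by have := hp.out.pos; lia⟩
  rw [hq, Finset.sum_range_succ', Nat.add_sub_cancel, Finset.range_eq_Ico,
    Finset.sum_Ico_add' (fun a : ℕ => (a : ℚ) ^ m) 0 q 1]
  simp [hm, Finset.Ico_add_one_right_eq_Icc]

/-- The main part of the `p`-adic expansion of `∑ a ^ (ν (p - 1))`. -/
def momentMain (p ν : ℕ) : ℚ :=
  p - 1 + p * (ν * (p - 1) * Bbar p ν
    + ν * (p - 1) * (ν * (p - 1) - 1) * (ν * (p - 1) - 2) / 6 * p ^ 2 * BbarSub p ν 2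
    + ν * (p - 1) * (ν * (p - 1) - 1) * (ν * (p - 1) - 2) * (ν * (p - 1) - 3)
        * (ν * (p - 1) - 4) / 120 * p ^ 4 * BbarSub p ν 4)

theorem cast_choose_four (m : ℕ) :
    (m.choose 4 : ℚ) = m * (m - 1) * (m - 2) * (m - 3) / 24 := by
  rw [Nat.cast_choose_eq_ascPochhammer_div]
  simp [ascPochhammer_succ_eval, Nat.factorial]
  rcases m with _ | _ | _ | m <;> simp
  ring

/-- Replaces the Bernoulli numbers in the truncated Faulhaber formula by divided ones. The shift by
1/p - 1 in `Bbar` becomes the constant p - 1, which later cancels in the alternating binomial sum.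
-/
theorem exists_sum_Icc_pow_eq (h7 : 7 ≤ p) {ν : ℕ} (hν : ν ≠ 0) (r : ℕ)
    (h : DivPow p r ((∑ a ∈ Finset.range p, (a : ℚ) ^ (ν * (p - 1))) / p -
      (bernoulli (ν * (p - 1))
        + (ν * (p - 1)).choose 2 * bernoulli (ν * (p - 1) - 2) * (p : ℚ) ^ 2 / 3
        + (ν * (p - 1)).choose 4 * bernoulli (ν * (p - 1) - 4) * (p : ℚ) ^ 4 / 5))) :
    ∃ t : integralSubring p, ∑ a ∈ Finset.Icc 1 (p - 1), (a : ℚ) ^ (ν * (p - 1)) =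
      momentMain p ν + p * (p ^ r * t) := by
  have h1 : (p : ℚ) - 1 ≠ 0 := by
    have : (7 : ℚ) ≤ p := by exact_mod_cast h7
    linarith
  have hνQ : (ν : ℚ) ≠ 0 := by exact_mod_cast hν
  have hm : p - 1 ≤ ν * (p - 1) := Nat.le_mul_of_pos_left _ (Nat.pos_of_ne_zero hν)
  have hmQ : ((ν * (p - 1) : ℕ) : ℚ) = ν * (p - 1) := by
    rw [Nat.cast_mul, Nat.cast_sub (by lia), Nat.cast_one]
  have hm6 : (6 : ℚ) ≤ ν * (p - 1) := by
    rw [← hmQ]; exact_mod_cast (by lia : 6 ≤ ν * (p - 1))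
  have h2 : (ν : ℚ) * (p - 1) - 2 ≠ 0 := by linarith
  have h4 : (ν : ℚ) * (p - 1) - 4 ≠ 0 := by linarith
  obtain ⟨t, ht⟩ := h.exists_integralSubring
  refine ⟨t, ?_⟩
  have e0 : bernoulli (ν * (p - 1)) = ν * (p - 1) * Bbar p ν + 1 - 1 / p := by
    rw [Bbar, mul_div_cancel₀ _ (mul_ne_zero hνQ h1)]
    ring
  have e2 : bernoulli (ν * (p - 1) - 2) = (ν * (p - 1) - 2) * BbarSub p ν 2 := by
    rw [BbarSub, Nat.cast_ofNat, mul_div_cancel₀ _ h2]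
  have e4 : bernoulli (ν * (p - 1) - 4) = (ν * (p - 1) - 4) * BbarSub p ν 4 := by
    rw [BbarSub, Nat.cast_ofNat, mul_div_cancel₀ _ h4]
  rw [e0, e2, e4, Nat.cast_choose_two, cast_choose_four, hmQ] at ht
  rw [← ht, sum_Icc_pow_eq (by lia), momentMain]
  field_simp
  ring

/-- Newton expansion of the divided Bernoulli numbers `B_{ν (p - 1) - d} / (ν (p - 1) - d)`. -/
theorem exists_bbarSub_eq {d M : ℕ} (hd : d ≠ 0) (hM : 1 ≤ M) (hdM : M + d + 2 ≤ p) (L : ℕ) :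
    ∃ c e : ℕ → integralSubring p, ∀ n ≤ L, BbarSub p (n + 1) d =
      ∑ r ∈ Finset.range M, (n.choose r : ℚ) * (p : ℚ) ^ r * c r + (p : ℚ) ^ M * e (n + 1) := by
  have h2 : p ≠ 2 := by lia
  obtain ⟨c, hc, h⟩ := exists_newton_bernoulli_div h2 hd (by lia) M L
  have key : ∀ n ≤ L, DivPow p M (BbarSub p (n + 1) d -
      ∑ r ∈ Finset.range M, (n.choose r : ℚ) * (p : ℚ) ^ r * c r) := by
    intro n hn
    have hk : n * (p - 1) + (p - 1 - d) ≠ 0 := by lia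
    have hB : BbarSub p (n + 1) d =
        bernoulli (n * (p - 1) + (p - 1 - d)) / (n * (p - 1) + (p - 1 - d) : ℕ) := by
      have e1 : (n + 1) * (p - 1) - d = n * (p - 1) + (p - 1 - d) := by
        rw [add_mul, one_mul]; lia
      have e2 : ((n * (p - 1) + (p - 1 - d) : ℕ) : ℚ) = ((n + 1 : ℕ) : ℚ) * ((p : ℚ) - 1) - d := by
        rw [Nat.cast_add, Nat.cast_mul, Nat.cast_sub (by lia : d ≤ p - 1),
          Nat.cast_sub (by lia : 1 ≤ p)]
        push_cast
        ring
      rw [BbarSub, e1, e2]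
    have h1 := h n hn hk
    rw [← hB] at h1
    set k := n * (p - 1) + (p - 1 - d) with hkdef
    have hk2 : 2 ≤ k := by lia
    -- This is where M + d + 2 ≤ p matters: the Euler factor 1 - p^(k-1) is then invisible modulo
    -- p^M, once the divided Bernoulli number is known to be integral.
    have hkM : M ≤ k - 1 := by lia
    have hsum : ∀ t : ℕ, DivPow p 0
        (∑ r ∈ Finset.range t, (n.choose r : ℚ) * (p : ℚ) ^ r * c r) := fun t =>
      DivPow.sum fun r _ => by
        have := (divPow_natCast (p := p) (n.choose r * p ^ r)).mul (hc r)
        simpa using this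
    have hint : DivPow p 0 (BbarSub p (n + 1) d) := by
      refine DivPow.of_unit_mul (u := 1 - p ^ (k - 1)) ?_ ?_
      · intro hdvd
        have h3 : (p : ℤ) ∣ p ^ (k - 1) := dvd_pow_self _ (by lia)
        have h4 : (p : ℤ) ∣ 1 := by simpa using dvd_add hdvd h3
        exact hp.out.one_lt.ne' (by exact_mod_cast Int.eq_one_of_dvd_one (by positivity) h4)
      · have := (h1.mono (by positivity : (0 : ℤ) ≤ M)).add (hsum (n + 1))
        push_cast
        simpa using this
    have htail : DivPow p M (∑ r ∈ Finset.range (n + 1), (n.choose r : ℚ) * (p : ℚ) ^ r * c r -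
        ∑ r ∈ Finset.range M, (n.choose r : ℚ) * (p : ℚ) ^ r * c r) := by
      -- Padding with vanishing binomial coefficients lets the series be cut at M even when n + 1 <
      -- M.
      have e1 : ∑ r ∈ Finset.range (n + 1), (n.choose r : ℚ) * (p : ℚ) ^ r * c r =
          ∑ r ∈ Finset.range (M + (n + 1)), (n.choose r : ℚ) * (p : ℚ) ^ r * c r := by
        refine Finset.sum_subset (by simp) fun r _ hr => ?_
        rw [Nat.choose_eq_zero_of_lt (by simpa using hr)]
        simp
      rw [e1, Finset.sum_range_add, add_sub_cancel_left]
      refine DivPow.sum fun r _ => ?_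
      have := ((divPow_natCast (p := p) (n.choose (M + r))).mul
        ((hc (M + r)).pow_mul (M + r)))
      rw [← mul_assoc] at this
      exact this.mono (by push_cast; lia)
    have h5 := ((hint.pow_mul (k - 1)).mono (by exact_mod_cast hkM : (M : ℤ) ≤ _)).add
      (h1.add htail)
    convert h5 using 1
    ring
  choose e he using fun (n : ℕ) (hn : n ≤ L) => (key n hn).exists_integralSubring
  -- Errors are indexed by ν = n + 1, hence the shift; the default 0 is never reached for n ≤ L.
  refine ⟨fun r => ⟨c r, hc r⟩, fun n => if hn : n - 1 ≤ L then e (n - 1) hn else 0, fun n hn => ?_⟩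
  simp only [Nat.add_sub_cancel, dif_pos hn]
  rw [← he n hn]
  ring

/-- Powers of this single element clear all the denominators below, whose prime factors are 2, 3 and
5. -/
theorem exists_inv_sixty (h7 : 7 ≤ p) : ∃ u : integralSubring p, (u : ℚ) = 1 / 60 := by
  have h : ¬ p ∣ 60 := by
    intro h
    have : p ∣ 2 ∨ p ∣ 3 ∨ p ∣ 5 := by
      rw [show 60 = 2 * (2 * (3 * 5)) by norm_num] at h
      simp only [hp.out.dvd_mul] at h
      tauto
    rcases this with h | h | h <;> have := Nat.le_of_dvd (by norm_num) h <;> lia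
  exact ⟨⟨_, divPow_inv_natCast h⟩, by simp⟩

/-- The extra factor p matches the expansion of p^n·Q_p(n), as the theorem concerns
p^(n-1)·Q_p(n)/n. The element `w` serves only to certify integrality of the left side. -/
theorem congrMod_of_mul_eq {k : ℕ} {x y : ℚ} (w z : integralSubring p) (hx : x = w)
    (h : (p : ℚ) * (x - y) = p * (p ^ k * z)) : CongrMod p k x y := by
  have h0 : (p : ℚ) ≠ 0 := by exact_mod_cast hp.out.ne_zero
  refine congrMod_of_divPow (hx ▸ w.2) ?_
  rw [mul_left_cancel₀ h0 h]
  exact DivPow.pow_mul k z.2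

end Expansion

/-! ### The individual congruences, by elimination of Newton coefficients -/

section Congruences

variable {p : ℕ} [hp : Fact p.Prime]

/-- These numbers enter with a factor p^2, so precision p^3 suffices modulo p^5; it is also the most
that M + d + 2 ≤ p permits at p = 7. For d = 4 the factor is p^4 and precision p suffices. -/
theorem exists_newton_two_of_seven_le (h7 : 7 ≤ p) : ∃ a e : ℕ → integralSubring p, ∀ n ≤ 5,
    BbarSub p (n + 1) 2 = a 0 + n * p * a 1 + n * (n - 1) / 2 * p ^ 2 * a 2
      + p ^ 3 * e (n + 1) := by
  obtain ⟨c, e, h⟩ := exists_bbarSub_eq (p := p) (d := 2) (M := 3) (by lia) (by lia) (by lia) 5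
  refine ⟨c, e, fun n hn => ?_⟩
  rw [h n hn]
  simp only [Finset.sum_range_succ, Finset.sum_range_zero, Nat.choose_zero_right,
    Nat.choose_one_right, Nat.cast_choose_two]
  push_cast
  ring

theorem exists_newton_four_of_seven_le (h7 : 7 ≤ p) : ∃ b f : ℕ → integralSubring p, ∀ n ≤ 5,
    BbarSub p (n + 1) 4 = b 0 + p * f (n + 1) := by
  obtain ⟨c, e, h⟩ := exists_bbarSub_eq (p := p) (d := 4) (M := 1) (by lia) (by lia) (by lia) 5
  refine ⟨c, e, fun n hn => ?_⟩
  rw [h n hn]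
  simp

theorem cast_choose_three (n : ℕ) : (n.choose 3 : ℚ) = n * (n - 1) * (n - 2) / 6 := by
  rw [Nat.cast_choose_eq_ascPochhammer_div]
  simp [ascPochhammer_succ_eval, Nat.factorial]
  rcases n with _ | _ | n <;> simp
  ring

/-- One more Newton term than for p ≥ 7, as the target is now modulo p^6; likewise for d = 4. -/
theorem exists_newton_two_of_eleven_le (h11 : 11 ≤ p) : ∃ a e : ℕ → integralSubring p, ∀ n ≤ 5,
    BbarSub p (n + 1) 2 = a 0 + n * p * a 1 + n * (n - 1) / 2 * p ^ 2 * a 2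
      + n * (n - 1) * (n - 2) / 6 * p ^ 3 * a 3 + p ^ 4 * e (n + 1) := by
  obtain ⟨c, e, h⟩ := exists_bbarSub_eq (p := p) (d := 2) (M := 4) (by lia) (by lia) (by lia) 5
  refine ⟨c, e, fun n hn => ?_⟩
  rw [h n hn]
  simp only [Finset.sum_range_succ, Finset.sum_range_zero, Nat.choose_zero_right,
    Nat.choose_one_right, Nat.cast_choose_two, cast_choose_three]
  push_cast
  ring

theorem exists_newton_four_of_eleven_le (h11 : 11 ≤ p) : ∃ b f : ℕ → integralSubring p, ∀ n ≤ 5,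
    BbarSub p (n + 1) 4 = b 0 + n * p * b 1 + p ^ 2 * f (n + 1) := by
  obtain ⟨c, e, h⟩ := exists_bbarSub_eq (p := p) (d := 4) (M := 2) (by lia) (by lia) (by lia) 5
  refine ⟨c, e, fun n hn => ?_⟩
  rw [h n hn]
  simp only [Finset.sum_range_succ, Finset.sum_range_zero, Nat.choose_zero_right,
    Nat.choose_one_right]
  push_cast
  ring

theorem exists_powerSum_expansion_five (h7 : 7 ≤ p) :
    ∃ t : ℕ → integralSubring p, ∀ n ≤ 5, (p : ℚ) ^ n * powerSum p n =
      (-1) ^ n * (p - 1) + ∑ ν ∈ Finset.range n, (-1) ^ (n - (ν + 1)) * (n.choose (ν + 1) : ℚ) *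
        (momentMain p (ν + 1) + p * (p ^ 5 * t (ν + 1))) := by
  choose t ht using fun (ν : ℕ) (hν : ν + 1 ≤ 5) =>
    exists_sum_Icc_pow_eq h7 ν.succ_ne_zero 5 (divPow_sum_range_pow_five h7 ν.succ_ne_zero hν)
  refine ⟨fun ν => if h : ν - 1 + 1 ≤ 5 then t (ν - 1) h else 0, fun n hn => ?_⟩
  -- The ν = 0 term is split off: its power sum is p - 1, whereas a sum over `range p` would also
  -- count 0^0.
  rw [prime_pow_mul_powerSum, Finset.sum_range_succ', add_comm]
  congr 1
  · simp [Nat.cast_sub hp.out.one_le]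
  · refine Finset.sum_congr rfl fun ν hν => ?_
    have h : ν + 1 ≤ 5 := (Nat.succ_le_of_lt (Finset.mem_range.1 hν)).trans hn
    simp only [Nat.add_sub_cancel, dif_pos h]
    rw [← ht ν h]

theorem exists_powerSum_expansion_six (h11 : 11 ≤ p) :
    ∃ t : ℕ → integralSubring p, ∀ n, (p : ℚ) ^ n * powerSum p n =
      (-1) ^ n * (p - 1) + ∑ ν ∈ Finset.range n, (-1) ^ (n - (ν + 1)) * (n.choose (ν + 1) : ℚ) *
        (momentMain p (ν + 1) + p * (p ^ 6 * t (ν + 1))) := by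
  choose t ht using fun (ν : ℕ) => exists_sum_Icc_pow_eq (p := p) (by lia) ν.succ_ne_zero 6
    (divPow_sum_range_pow_six h11 ν.succ_ne_zero)
  refine ⟨fun ν => t (ν - 1), fun n => ?_⟩
  rw [prime_pow_mul_powerSum, Finset.sum_range_succ', add_comm]
  congr 1
  · simp [Nat.cast_sub hp.out.one_le]
  · refine Finset.sum_congr rfl fun ν _ => ?_
    simp only [Nat.add_sub_cancel]
    rw [← ht ν]

theorem congrMod_powerSum_one_of_seven_le (h7 : 7 ≤ p) :
      CongrMod p 5 (powerSum p 1)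
        (((p : ℚ) - 1) * Bbar p 1
          - (p : ℚ) ^ 2 * BbarSub p 1 2
          + 11 / 6 * (p : ℚ) ^ 3 * BbarSub p 1 2
          - (p : ℚ) ^ 4 * (BbarSub p 1 2 + BbarSub p 1 4)) := by
  obtain ⟨u, hu⟩ := exists_inv_sixty (p := p) (by lia)
  obtain ⟨a, e, hα⟩ := exists_newton_two_of_seven_le h7
  obtain ⟨b, f, hβ⟩ := exists_newton_four_of_seven_le h7
  obtain ⟨t, ht⟩ := exists_powerSum_expansion_five h7
  obtain ⟨q, hq⟩ := exists_powerSum_eq (p := p) 1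
  have hα1 := hα 0 (by norm_num)
  have hβ1 := hβ 0 (by norm_num)
  have hQ := ht 1 (by norm_num)
  norm_num only at hα1 hβ1
  simp only [Finset.sum_range_succ, Finset.sum_range_zero, momentMain, zero_add,
    hα1, hβ1, hq] at hQ
  norm_num only [Nat.choose] at hQ
  obtain ⟨π, hπp⟩ : ∃ π : integralSubring p, (π : ℚ) = p := ⟨(p : integralSubring p), by simp⟩
  -- The witness is the explicit quotient of the remainder by p^6 (the modulus p^5 times the common
  -- factor p), with denominators cleared by u^2 = 1/3600. The other congruences follow this
  -- pattern, with 60u/n representing 1/n.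
  refine congrMod_of_mul_eq (60 * u * q) (u ^ 2 * (600 * a 0
          + (8220 - 6750 * π + 2550 * π ^ 2 - 450 * π ^ 3 + 30 * π ^ 4) * b 0
          + 3600 * t 1
          + (8220 * π - 6750 * π ^ 2 + 2550 * π ^ 3 - 450 * π ^ 4 + 30 * π ^ 5) * f 1
          + (600 * π ^ 3) * e 1)) ?_ ?_
  · rw [hq]
    push_cast [integralSubring_coe_ofNat]
    rw [hu]
    ring
  · simp only [hα1, hβ1, hq]
    push_cast [integralSubring_coe_ofNat]
    rw [hu, hπp]
    linear_combination hQ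

theorem congrMod_powerSum_two_of_seven_le (h7 : 7 ≤ p) :
      CongrMod p 5 (1 / 2 * (p : ℚ) * powerSum p 2)
        (((p : ℚ) - 1) * (Bbar p 2 - Bbar p 1)
          + (p : ℚ) ^ 2 * (BbarSub p 1 2 - 2 * BbarSub p 2 2)
          + (p : ℚ) ^ 3 * (-11 / 6 * BbarSub p 1 2 + 13 / 3 * BbarSub p 2 2)
          - (p : ℚ) ^ 4 * (2 * BbarSub p 1 2 + 2 * BbarSub p 1 4)) := by
  obtain ⟨u, hu⟩ := exists_inv_sixty (p := p) (by lia)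
  obtain ⟨a, e, hα⟩ := exists_newton_two_of_seven_le h7
  obtain ⟨b, f, hβ⟩ := exists_newton_four_of_seven_le h7
  obtain ⟨t, ht⟩ := exists_powerSum_expansion_five h7
  obtain ⟨q, hq⟩ := exists_powerSum_eq (p := p) 2
  have hα1 := hα 0 (by norm_num)
  have hβ1 := hβ 0 (by norm_num)
  have hα2 := hα 1 (by norm_num)
  have hβ2 := hβ 1 (by norm_num)
  have hQ := ht 2 (by norm_num)
  norm_num only at hα1 hβ1 hα2 hβ2
  simp only [Finset.sum_range_succ, Finset.sum_range_zero, momentMain, zero_add, Nat.reduceAdd,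
    hα1, hβ1, hα2, hβ2, hq] at hQ
  norm_num only [Nat.choose] at hQ
  obtain ⟨π, hπp⟩ : ∃ π : integralSubring p, (π : ℚ) = p := ⟨(p : integralSubring p), by simp⟩
  refine congrMod_of_mul_eq (30 * u * π * q) (u ^ 2 * (1800 * a 0
          + (-10800 + 2400 * π) * a 1
          + (23100 - 28050 * π + 16050 * π ^ 2 - 4350 * π ^ 3 + 450 * π ^ 4) * b 0
          + (10800 - 8220 * π + 6750 * π ^ 2 - 2550 * π ^ 3 + 450 * π ^ 4 - 30 * π ^ 5) * f 1
          + (-10800 + 31320 * π - 34800 * π ^ 2 + 18600 * π ^ 3 - 4800 * π ^ 4 + 480 * π ^ 5) * f 2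
          + (-3600) * t 1
          + 1800 * t 2
          + (10800 * π ^ 2 - 600 * π ^ 3) * e 1
          + (-10800 * π ^ 2 + 2400 * π ^ 3) * e 2)) ?_ ?_
  · rw [hq]
    push_cast [integralSubring_coe_ofNat]
    rw [hu, hπp]
    ring
  · simp only [hα1, hβ1, hα2, hq]
    push_cast [integralSubring_coe_ofNat]
    rw [hu, hπp]
    linear_combination (1 / 2) * hQ

theorem congrMod_powerSum_three_of_seven_le (h7 : 7 ≤ p) :
      CongrMod p 5 (1 / 3 * (p : ℚ) ^ 2 * powerSum p 3)
        (((p : ℚ) - 1) * (Bbar p 3 - 2 * Bbar p 2 + Bbar p 1)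
          + (p : ℚ) ^ 2 * (-BbarSub p 1 2 + 4 * BbarSub p 2 2 - 10 / 3 * BbarSub p 3 2)
          + (p : ℚ) ^ 3 * (-6 * BbarSub p 1 2 + 7 * BbarSub p 2 2)
          - (p : ℚ) ^ 4 * (BbarSub p 1 2 + 2 * BbarSub p 1 4)) := by
  obtain ⟨u, hu⟩ := exists_inv_sixty (p := p) (by lia)
  obtain ⟨a, e, hα⟩ := exists_newton_two_of_seven_le h7
  obtain ⟨b, f, hβ⟩ := exists_newton_four_of_seven_le h7
  obtain ⟨t, ht⟩ := exists_powerSum_expansion_five h7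
  obtain ⟨q, hq⟩ := exists_powerSum_eq (p := p) 3
  have hα1 := hα 0 (by norm_num)
  have hβ1 := hβ 0 (by norm_num)
  have hα2 := hα 1 (by norm_num)
  have hβ2 := hβ 1 (by norm_num)
  have hα3 := hα 2 (by norm_num)
  have hβ3 := hβ 2 (by norm_num)
  have hQ := ht 3 (by norm_num)
  norm_num only at hα1 hβ1 hα2 hβ2 hα3 hβ3
  simp only [Finset.sum_range_succ, Finset.sum_range_zero, momentMain, zero_add, Nat.reduceAdd,
    hα1, hβ1, hα2, hβ2, hα3, hβ3, hq] at hQ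
  norm_num only [Nat.choose] at hQ
  obtain ⟨π, hπp⟩ : ∃ π : integralSubring p, (π : ℚ) = p := ⟨(p : integralSubring p), by simp⟩
  refine congrMod_of_mul_eq (20 * u * π ^ 2 * q) (u ^ 2 * (1200 * a 0
          + (-21600 + 6000 * π) * a 1
          + (28200 - 21600 * π + 5400 * π ^ 2) * a 2
          + (28200 - 42900 * π + 31500 * π ^ 2 - 11100 * π ^ 3 + 1500 * π ^ 4) * b 0
          + (3600 + 8220 * π - 6750 * π ^ 2 + 2550 * π ^ 3 - 450 * π ^ 4 + 30 * π ^ 5) * f 1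
          + (21600 - 62640 * π + 69600 * π ^ 2 - 37200 * π ^ 3 + 9600 * π ^ 4 - 960 * π ^ 5) * f 2
          + (-25200 + 82620 * π - 105750 * π ^ 2 + 66150 * π ^ 3 - 20250 * π ^ 4 + 2430 * π ^ 5) * f 3
          + 3600 * t 1
          + (-3600) * t 2
          + 1200 * t 3
          + (28200 * π + 600 * π ^ 3) * e 1
          + (-56400 * π + 21600 * π ^ 2 - 4800 * π ^ 3) * e 2
          + (28200 * π - 21600 * π ^ 2 + 5400 * π ^ 3) * e 3)) ?_ ?_
  · rw [hq]
    push_cast [integralSubring_coe_ofNat]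
    rw [hu, hπp]
    ring
  · simp only [hα1, hβ1, hα2, hα3, hq]
    push_cast [integralSubring_coe_ofNat]
    rw [hu, hπp]
    linear_combination (1 / 3) * hQ

theorem congrMod_powerSum_four_of_seven_le (h7 : 7 ≤ p) :
      CongrMod p 5 (1 / 4 * (p : ℚ) ^ 3 * powerSum p 4)
        (((p : ℚ) - 1) * (Bbar p 4 - 3 * Bbar p 3 + 3 * Bbar p 2 - Bbar p 1)
          + (p : ℚ) ^ 2 * (-4 * BbarSub p 1 2 + 9 * BbarSub p 2 2 - 5 * BbarSub p 3 2)
          + (p : ℚ) ^ 3 * (-3 * BbarSub p 1 2 + 3 * BbarSub p 2 2)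
          - (p : ℚ) ^ 4 * BbarSub p 1 4) := by
  obtain ⟨u, hu⟩ := exists_inv_sixty (p := p) (by lia)
  obtain ⟨a, e, hα⟩ := exists_newton_two_of_seven_le h7
  obtain ⟨b, f, hβ⟩ := exists_newton_four_of_seven_le h7
  obtain ⟨t, ht⟩ := exists_powerSum_expansion_five h7
  obtain ⟨q, hq⟩ := exists_powerSum_eq (p := p) 4
  have hα1 := hα 0 (by norm_num)
  have hβ1 := hβ 0 (by norm_num)
  have hα2 := hα 1 (by norm_num)
  have hβ2 := hβ 1 (by norm_num)
  have hα3 := hα 2 (by norm_num)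
  have hβ3 := hβ 2 (by norm_num)
  have hα4 := hα 3 (by norm_num)
  have hβ4 := hβ 3 (by norm_num)
  have hQ := ht 4 (by norm_num)
  norm_num only at hα1 hβ1 hα2 hβ2 hα3 hβ3 hα4 hβ4
  simp only [Finset.sum_range_succ, Finset.sum_range_zero, momentMain, zero_add, Nat.reduceAdd,
    hα1, hβ1, hα2, hβ2, hα3, hβ3, hα4, hβ4, hq] at hQ
  norm_num only [Nat.choose] at hQ
  obtain ⟨π, hπp⟩ : ∃ π : integralSubring p, (π : ℚ) = p := ⟨(p : integralSubring p), by simp⟩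
  refine congrMod_of_mul_eq (15 * u * π ^ 3 * q) (u ^ 2 * ((-10800 + 3600 * π) * a 1
          + (48600 - 43200 * π + 12600 * π ^ 2) * a 2
          + (16200 - 28800 * π + 25200 * π ^ 2 - 10800 * π ^ 3 + 1800 * π ^ 4) * b 0
          + (18000 + 4200 * π + 3600 * π ^ 2 - 600 * π ^ 3) * e 1
          + (-54000 + 36000 * π - 32400 * π ^ 2 + 7200 * π ^ 3) * e 2
          + (54000 - 84600 * π + 64800 * π ^ 2 - 16200 * π ^ 3) * e 3
          + (-18000 + 44400 * π - 36000 * π ^ 2 + 9600 * π ^ 3) * e 4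
          + (7200 - 8220 * π + 6750 * π ^ 2 - 2550 * π ^ 3 + 450 * π ^ 4 - 30 * π ^ 5) * f 1
          + (-32400 + 93960 * π - 104400 * π ^ 2 + 55800 * π ^ 3 - 14400 * π ^ 4 + 1440 * π ^ 5) * f 2
          + (75600 - 247860 * π + 317250 * π ^ 2 - 198450 * π ^ 3 + 60750 * π ^ 4 - 7290 * π ^ 5) * f 3
          + (-50400 + 178320 * π - 248400 * π ^ 2 + 170400 * π ^ 3 - 57600 * π ^ 4 + 7680 * π ^ 5) * f 4
          + (-3600) * t 1
          + 5400 * t 2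
          + (-3600) * t 3
          + 900 * t 4)) ?_ ?_
  · rw [hq]
    push_cast [integralSubring_coe_ofNat]
    rw [hu, hπp]
    ring
  · simp only [hα1, hβ1, hα2, hα3, hq]
    push_cast [integralSubring_coe_ofNat]
    rw [hu, hπp]
    linear_combination (1 / 4) * hQ

theorem congrMod_powerSum_five_of_seven_le (h7 : 7 ≤ p) :
      CongrMod p 5 (1 / 5 * (p : ℚ) ^ 4 * powerSum p 5)
        (-(Bbar p 5 - 4 * Bbar p 4 + 6 * Bbar p 3 - 4 * Bbar p 2 + Bbar p 1)
          + (p : ℚ) ^ 2 * (-2 * BbarSub p 1 2 + 4 * BbarSub p 2 2 - 2 * BbarSub p 3 2)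
          - 1 / 5 * (p : ℚ) ^ 4 * BbarSub p 1 4) := by
  have h0 : (p : ℚ) ≠ 0 := by exact_mod_cast hp.out.ne_zero
  obtain ⟨u, hu⟩ := exists_inv_sixty (p := p) (by lia)
  obtain ⟨a, e, hα⟩ := exists_newton_two_of_seven_le h7
  obtain ⟨b, f, hβ⟩ := exists_newton_four_of_seven_le h7
  obtain ⟨t, ht⟩ := exists_powerSum_expansion_five h7
  obtain ⟨q, hq⟩ := exists_powerSum_eq (p := p) 5
  have hα1 := hα 0 (by norm_num)
  have hβ1 := hβ 0 (by norm_num)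
  have hα2 := hα 1 (by norm_num)
  have hβ2 := hβ 1 (by norm_num)
  have hα3 := hα 2 (by norm_num)
  have hβ3 := hβ 2 (by norm_num)
  have hα4 := hα 3 (by norm_num)
  have hβ4 := hβ 3 (by norm_num)
  have hα5 := hα 4 (by norm_num)
  have hβ5 := hβ 4 (by norm_num)
  have hQ := ht 5 (by norm_num)
  norm_num only at hα1 hβ1 hα2 hβ2 hα3 hβ3 hα4 hβ4 hα5 hβ5
  simp only [Finset.sum_range_succ, Finset.sum_range_zero, momentMain, zero_add, Nat.reduceAdd,
    hα1, hβ1, hα2, hβ2, hα3, hβ3, hα4, hβ4, hα5, hβ5, hq] at hQ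
  norm_num only [Nat.choose] at hQ
  obtain ⟨π, hπp⟩ : ∃ π : integralSubring p, (π : ℚ) = p := ⟨(p : integralSubring p), by simp⟩
  -- The right side has -1 in place of p - 1, an error of p times the fourth difference of `Bbar`.
  -- The same expansion shows that p - 1 times this difference is divisible by p^4, and p - 1 is a
  -- unit.
  obtain ⟨δ, hδ⟩ : ∃ δ : integralSubring p,
      Bbar p 5 - 4 * Bbar p 4 + 6 * Bbar p 3 - 4 * Bbar p 2 + Bbar p 1 = (p : ℚ) ^ 4 * δ := by
    refine DivPow.exists_integralSubring 4 (DivPow.of_unit_mul (u := p - 1) ?_ ?_)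
    · intro h
      have h1 : (p : ℤ) ∣ 1 := by simpa using (dvd_refl (p : ℤ)).sub h
      exact hp.out.one_lt.ne' (by exact_mod_cast Int.eq_one_of_dvd_one (by positivity) h1)
    · set w : integralSubring p := 12 * u * q - u ^ 2 * ((-7200 + 21600 * π - 21600 * π ^ 2 + 7200 * π ^ 3) * a 2
          + (-720 + 3600 * π - 7200 * π ^ 2 + 7200 * π ^ 3 - 3600 * π ^ 4 + 720 * π ^ 5) * b 0
          + (-3600 * π + 6600 * π ^ 2 - 3600 * π ^ 3 + 600 * π ^ 4) * e 1
          + (28800 * π - 62400 * π ^ 2 + 43200 * π ^ 3 - 9600 * π ^ 4) * e 2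
          + (-72000 * π + 169200 * π ^ 2 - 129600 * π ^ 3 + 32400 * π ^ 4) * e 3
          + (72000 * π - 177600 * π ^ 2 + 144000 * π ^ 3 - 38400 * π ^ 4) * e 4
          + (-25200 * π + 64200 * π ^ 2 - 54000 * π ^ 3 + 15000 * π ^ 4) * e 5
          + (-3600 * π + 8220 * π ^ 2 - 6750 * π ^ 3 + 2550 * π ^ 4 - 450 * π ^ 5 + 30 * π ^ 6) * f 1
          + (43200 * π - 125280 * π ^ 2 + 139200 * π ^ 3 - 74400 * π ^ 4 + 19200 * π ^ 5 - 1920 * π ^ 6) * f 2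
          + (-151200 * π + 495720 * π ^ 2 - 634500 * π ^ 3 + 396900 * π ^ 4 - 121500 * π ^ 5 + 14580 * π ^ 6) * f 3
          + (201600 * π - 713280 * π ^ 2 + 993600 * π ^ 3 - 681600 * π ^ 4 + 230400 * π ^ 5 - 30720 * π ^ 6) * f 4
          + (-90720 * π + 338220 * π ^ 2 - 498750 * π ^ 3 + 363750 * π ^ 4 - 131250 * π ^ 5 + 18750 * π ^ 6) * f 5
          + (3600 * π) * t 1
          + (-7200 * π) * t 2
          + (7200 * π) * t 3
          + (-3600 * π) * t 4
          + (720 * π) * t 5) with hw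
      have hΔ : ((p - 1 : ℤ) : ℚ) * (Bbar p 5 - 4 * Bbar p 4 + 6 * Bbar p 3 - 4 * Bbar p 2 + Bbar p 1) = p ^ 4 * w := by
        refine mul_left_cancel₀ h0 ?_
        rw [hw]
        push_cast [integralSubring_coe_ofNat]
        rw [hu, hπp]
        linear_combination (-1 / 5) * hQ
      rw [hΔ]
      exact DivPow.pow_mul 4 w.2
  refine congrMod_of_mul_eq (12 * u * π ^ 4 * q) (u ^ 2 * ((21600 - 21600 * π + 7200 * π ^ 2) * a 2
          + (3600 - 7200 * π + 7200 * π ^ 2 - 3600 * π ^ 3 + 720 * π ^ 4) * b 0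
          + (3600 + 6600 * π - 3600 * π ^ 2 + 600 * π ^ 3) * e 1
          + (14400 - 62400 * π + 43200 * π ^ 2 - 9600 * π ^ 3) * e 2
          + (-64800 + 169200 * π - 129600 * π ^ 2 + 32400 * π ^ 3) * e 3
          + (72000 - 177600 * π + 144000 * π ^ 2 - 38400 * π ^ 3) * e 4
          + (-25200 + 64200 * π - 54000 * π ^ 2 + 15000 * π ^ 3) * e 5
          + (-2880 + 8220 * π - 6750 * π ^ 2 + 2550 * π ^ 3 - 450 * π ^ 4 + 30 * π ^ 5) * f 1
          + (43200 - 125280 * π + 139200 * π ^ 2 - 74400 * π ^ 3 + 19200 * π ^ 4 - 1920 * π ^ 5) * f 2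
          + (-151200 + 495720 * π - 634500 * π ^ 2 + 396900 * π ^ 3 - 121500 * π ^ 4 + 14580 * π ^ 5) * f 3
          + (201600 - 713280 * π + 993600 * π ^ 2 - 681600 * π ^ 3 + 230400 * π ^ 4 - 30720 * π ^ 5) * f 4
          + (-90720 + 338220 * π - 498750 * π ^ 2 + 363750 * π ^ 3 - 131250 * π ^ 4 + 18750 * π ^ 5) * f 5
          + 3600 * t 1
          + (-7200) * t 2
          + 7200 * t 3
          + (-3600) * t 4
          + 720 * t 5) + δ) ?_ ?_
  · rw [hq]
    push_cast [integralSubring_coe_ofNat]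
    rw [hu, hπp]
    ring
  · simp only [hα1, hβ1, hα2, hα3, hq]
    push_cast [integralSubring_coe_ofNat]
    rw [hu, hπp]
    linear_combination (1 / 5) * hQ + p ^ 2 * hδ

/-! ### Congruences modulo p^6 -/

theorem congrMod_powerSum_one_of_eleven_le (h11 : 11 ≤ p) :
      CongrMod p 6 (powerSum p 1)
        (((p : ℚ) - 1) * Bbar p 1
          - (p : ℚ) ^ 2 * BbarSub p 1 2
          + 11 / 6 * (p : ℚ) ^ 3 * BbarSub p 1 2
          - (p : ℚ) ^ 4 * (BbarSub p 1 2 + BbarSub p 1 4)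
          + (p : ℚ) ^ 5 * (1 / 6 * BbarSub p 1 2 + 137 / 60 * BbarSub p 1 4)) := by
  obtain ⟨u, hu⟩ := exists_inv_sixty (p := p) (by lia)
  obtain ⟨a, e, hα⟩ := exists_newton_two_of_eleven_le h11
  obtain ⟨b, f, hβ⟩ := exists_newton_four_of_eleven_le h11
  obtain ⟨t, ht⟩ := exists_powerSum_expansion_six h11
  obtain ⟨q, hq⟩ := exists_powerSum_eq (p := p) 1
  have hα1 := hα 0 (by norm_num)
  have hβ1 := hβ 0 (by norm_num)
  have hQ := ht 1
  norm_num only at hα1 hβ1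
  simp only [Finset.sum_range_succ, Finset.sum_range_zero, momentMain, zero_add,
    hα1, hβ1, hq] at hQ
  norm_num only [Nat.choose] at hQ
  obtain ⟨π, hπp⟩ : ∃ π : integralSubring p, (π : ℚ) = p := ⟨(p : integralSubring p), by simp⟩
  refine congrMod_of_mul_eq (60 * u * q) (u ^ 2 * ((-6750 + 2550 * π - 450 * π ^ 2 + 30 * π ^ 3) * b 0
          + 3600 * t 1
          + (-6750 * π ^ 2 + 2550 * π ^ 3 - 450 * π ^ 4 + 30 * π ^ 5) * f 1)) ?_ ?_
  · rw [hq]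
    push_cast [integralSubring_coe_ofNat]
    rw [hu]
    ring
  · simp only [hα1, hβ1, hq]
    push_cast [integralSubring_coe_ofNat]
    rw [hu, hπp]
    linear_combination hQ

theorem congrMod_powerSum_two_of_eleven_le (h11 : 11 ≤ p) :
      CongrMod p 6 (1 / 2 * (p : ℚ) * powerSum p 2)
        (((p : ℚ) - 1) * (Bbar p 2 - Bbar p 1)
          + (p : ℚ) ^ 2 * (BbarSub p 1 2 - 2 * BbarSub p 2 2)
          + (p : ℚ) ^ 3 * (-11 / 6 * BbarSub p 1 2 + 13 / 3 * BbarSub p 2 2)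
          + (p : ℚ) ^ 4 * (BbarSub p 1 2 - 3 * BbarSub p 2 2 + BbarSub p 1 4 - 3 * BbarSub p 2 4)
          + (p : ℚ) ^ 5 * (1 / 2 * BbarSub p 1 2 + 77 / 12 * BbarSub p 1 4)) := by
  obtain ⟨u, hu⟩ := exists_inv_sixty (p := p) (by lia)
  obtain ⟨a, e, hα⟩ := exists_newton_two_of_eleven_le h11
  obtain ⟨b, f, hβ⟩ := exists_newton_four_of_eleven_le h11
  obtain ⟨t, ht⟩ := exists_powerSum_expansion_six h11
  obtain ⟨q, hq⟩ := exists_powerSum_eq (p := p) 2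
  have hα1 := hα 0 (by norm_num)
  have hβ1 := hβ 0 (by norm_num)
  have hα2 := hα 1 (by norm_num)
  have hβ2 := hβ 1 (by norm_num)
  have hQ := ht 2
  norm_num only at hα1 hβ1 hα2 hβ2
  simp only [Finset.sum_range_succ, Finset.sum_range_zero, momentMain, zero_add, Nat.reduceAdd,
    hα1, hβ1, hα2, hβ2, hq] at hQ
  norm_num only [Nat.choose] at hQ
  obtain ⟨π, hπp⟩ : ∃ π : integralSubring p, (π : ℚ) = p := ⟨(p : integralSubring p), by simp⟩
  refine congrMod_of_mul_eq (30 * u * π * q) (u ^ 2 * (2400 * a 1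
          + (-28050 + 16050 * π - 4350 * π ^ 2 + 450 * π ^ 3) * b 0
          + (31320 - 34800 * π + 18600 * π ^ 2 - 4800 * π ^ 3 + 480 * π ^ 4) * b 1
          + (-3600) * t 1
          + 1800 * t 2
          + (-31320 * π + 6750 * π ^ 2 - 2550 * π ^ 3 + 450 * π ^ 4 - 30 * π ^ 5) * f 1
          + (31320 * π - 34800 * π ^ 2 + 18600 * π ^ 3 - 4800 * π ^ 4 + 480 * π ^ 5) * f 2
          + (-2400 * π ^ 3) * e 1
          + (2400 * π ^ 3) * e 2)) ?_ ?_
  · rw [hq]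
    push_cast [integralSubring_coe_ofNat]
    rw [hu, hπp]
    ring
  · simp only [hα1, hβ1, hα2, hβ2, hq]
    push_cast [integralSubring_coe_ofNat]
    rw [hu, hπp]
    linear_combination (1 / 2) * hQ

theorem congrMod_powerSum_three_of_eleven_le (h11 : 11 ≤ p) :
      CongrMod p 6 (1 / 3 * (p : ℚ) ^ 2 * powerSum p 3)
        (((p : ℚ) - 1) * (Bbar p 3 - 2 * Bbar p 2 + Bbar p 1)
          + (p : ℚ) ^ 2 * (-BbarSub p 1 2 + 4 * BbarSub p 2 2 - 10 / 3 * BbarSub p 3 2)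
          + (p : ℚ) ^ 3 * (11 / 6 * BbarSub p 1 2 - 26 / 3 * BbarSub p 2 2 + 47 / 6 * BbarSub p 3 2)
          + (p : ℚ) ^ 4 * (5 * BbarSub p 1 2 - 6 * BbarSub p 2 2 + 6 * BbarSub p 1 4 - 8 * BbarSub p 2 4)
          + (p : ℚ) ^ 5 * (1 / 3 * BbarSub p 1 2 + 47 / 6 * BbarSub p 1 4)) := by
  obtain ⟨u, hu⟩ := exists_inv_sixty (p := p) (by lia)
  obtain ⟨a, e, hα⟩ := exists_newton_two_of_eleven_le h11
  obtain ⟨b, f, hβ⟩ := exists_newton_four_of_eleven_le h11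
  obtain ⟨t, ht⟩ := exists_powerSum_expansion_six h11
  obtain ⟨q, hq⟩ := exists_powerSum_eq (p := p) 3
  have hα1 := hα 0 (by norm_num)
  have hβ1 := hβ 0 (by norm_num)
  have hα2 := hα 1 (by norm_num)
  have hβ2 := hβ 1 (by norm_num)
  have hα3 := hα 2 (by norm_num)
  have hβ3 := hβ 2 (by norm_num)
  have hQ := ht 3
  norm_num only at hα1 hβ1 hα2 hβ2 hα3 hβ3
  simp only [Finset.sum_range_succ, Finset.sum_range_zero, momentMain, zero_add, Nat.reduceAdd,
    hα1, hβ1, hα2, hβ2, hα3, hβ3, hq] at hQ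
  norm_num only [Nat.choose] at hQ
  obtain ⟨π, hπp⟩ : ∃ π : integralSubring p, (π : ℚ) = p := ⟨(p : integralSubring p), by simp⟩
  refine congrMod_of_mul_eq (20 * u * π ^ 2 * q) (u ^ 2 * (6000 * a 1
          + (-21600 + 5400 * π) * a 2
          + (-42900 + 31500 * π - 11100 * π ^ 2 + 1500 * π ^ 3) * b 0
          + (102600 - 141900 * π + 95100 * π ^ 2 - 30900 * π ^ 3 + 3900 * π ^ 4) * b 1
          + (-25200 - 19980 * π - 6750 * π ^ 2 + 2550 * π ^ 3 - 450 * π ^ 4 + 30 * π ^ 5) * f 1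
          + (50400 - 62640 * π + 69600 * π ^ 2 - 37200 * π ^ 3 + 9600 * π ^ 4 - 960 * π ^ 5) * f 2
          + (-25200 + 82620 * π - 105750 * π ^ 2 + 66150 * π ^ 3 - 20250 * π ^ 4 + 2430 * π ^ 5) * f 3
          + 3600 * t 1
          + (-3600) * t 2
          + 1200 * t 3
          + (-21600 * π ^ 2 - 600 * π ^ 3) * e 1
          + (43200 * π ^ 2 - 4800 * π ^ 3) * e 2
          + (-21600 * π ^ 2 + 5400 * π ^ 3) * e 3)) ?_ ?_
  · rw [hq]
    push_cast [integralSubring_coe_ofNat]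
    rw [hu, hπp]
    ring
  · simp only [hα1, hβ1, hα2, hβ2, hα3, hq]
    push_cast [integralSubring_coe_ofNat]
    rw [hu, hπp]
    linear_combination (1 / 3) * hQ

theorem congrMod_powerSum_four_of_eleven_le (h11 : 11 ≤ p) :
      CongrMod p 6 (1 / 4 * (p : ℚ) ^ 3 * powerSum p 4)
        (((p : ℚ) - 1) * (Bbar p 4 - 3 * Bbar p 3 + 3 * Bbar p 2 - Bbar p 1)
          + (p : ℚ) ^ 2 * (BbarSub p 1 2 - 6 * BbarSub p 2 2 + 10 * BbarSub p 3 2 - 5 * BbarSub p 4 2)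
          + (p : ℚ) ^ 3 * (21 / 2 * BbarSub p 1 2 - 24 * BbarSub p 2 2 + 27 / 2 * BbarSub p 3 2)
          + (p : ℚ) ^ 4 * (3 * BbarSub p 1 2 - 3 * BbarSub p 2 2 + 8 * BbarSub p 1 4 - 9 * BbarSub p 2 4)
          + 9 / 2 * (p : ℚ) ^ 5 * BbarSub p 1 4) := by
  obtain ⟨u, hu⟩ := exists_inv_sixty (p := p) (by lia)
  obtain ⟨a, e, hα⟩ := exists_newton_two_of_eleven_le h11
  obtain ⟨b, f, hβ⟩ := exists_newton_four_of_eleven_le h11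
  obtain ⟨t, ht⟩ := exists_powerSum_expansion_six h11
  obtain ⟨q, hq⟩ := exists_powerSum_eq (p := p) 4
  have hα1 := hα 0 (by norm_num)
  have hβ1 := hβ 0 (by norm_num)
  have hα2 := hα 1 (by norm_num)
  have hβ2 := hβ 1 (by norm_num)
  have hα3 := hα 2 (by norm_num)
  have hβ3 := hβ 2 (by norm_num)
  have hα4 := hα 3 (by norm_num)
  have hβ4 := hβ 3 (by norm_num)
  have hQ := ht 4
  norm_num only at hα1 hβ1 hα2 hβ2 hα3 hβ3 hα4 hβ4
  simp only [Finset.sum_range_succ, Finset.sum_range_zero, momentMain, zero_add, Nat.reduceAdd,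
    hα1, hβ1, hα2, hβ2, hα3, hβ3, hα4, hβ4, hq] at hQ
  norm_num only [Nat.choose] at hQ
  obtain ⟨π, hπp⟩ : ∃ π : integralSubring p, (π : ℚ) = p := ⟨(p : integralSubring p), by simp⟩
  refine congrMod_of_mul_eq (15 * u * π ^ 3 * q) (u ^ 2 * (3600 * a 1
          + (-43200 + 12600 * π) * a 2
          + (44400 - 36000 * π + 9600 * π ^ 2) * a 3
          + (-28800 + 25200 * π - 10800 * π ^ 2 + 1800 * π ^ 3) * b 0
          + (133200 - 215100 * π + 170100 * π ^ 2 - 65700 * π ^ 3 + 9900 * π ^ 4) * b 1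
          + (-25200 - 24420 * π + 6750 * π ^ 2 - 2550 * π ^ 3 + 450 * π ^ 4 - 30 * π ^ 5) * f 1
          + (75600 - 247860 * π + 317250 * π ^ 2 - 198450 * π ^ 3 + 60750 * π ^ 4 - 7290 * π ^ 5) * f 3
          + (-50400 + 178320 * π - 248400 * π ^ 2 + 170400 * π ^ 3 - 57600 * π ^ 4 + 7680 * π ^ 5) * f 4
          + (-3600) * t 1
          + 5400 * t 2
          + (-3600) * t 3
          + 900 * t 4
          + (-44400 * π - 7200 * π ^ 2 - 600 * π ^ 3) * e 1
          + (133200 * π - 21600 * π ^ 2 + 7200 * π ^ 3) * e 2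
          + (-133200 * π + 64800 * π ^ 2 - 16200 * π ^ 3) * e 3
          + (44400 * π - 36000 * π ^ 2 + 9600 * π ^ 3) * e 4
          + (93960 * π - 104400 * π ^ 2 + 55800 * π ^ 3 - 14400 * π ^ 4 + 1440 * π ^ 5) * f 2)) ?_ ?_
  · rw [hq]
    push_cast [integralSubring_coe_ofNat]
    rw [hu, hπp]
    ring
  · simp only [hα1, hβ1, hα2, hβ2, hα3, hα4, hq]
    push_cast [integralSubring_coe_ofNat]
    rw [hu, hπp]
    linear_combination (1 / 4) * hQ

theorem congrMod_powerSum_five_of_eleven_le (h11 : 11 ≤ p) :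
      CongrMod p 6 (1 / 5 * (p : ℚ) ^ 4 * powerSum p 5)
        (((p : ℚ) - 1) * (Bbar p 5 - 4 * Bbar p 4 + 6 * Bbar p 3 - 4 * Bbar p 2 + Bbar p 1)
          + (p : ℚ) ^ 2 * (6 * BbarSub p 1 2 - 20 * BbarSub p 2 2 + 22 * BbarSub p 3 2 - 8 * BbarSub p 4 2)
          + (p : ℚ) ^ 3 * (6 * BbarSub p 1 2 - 12 * BbarSub p 2 2 + 6 * BbarSub p 3 2)
          + (p : ℚ) ^ 4 * (23 / 5 * BbarSub p 1 4 - 24 / 5 * BbarSub p 2 4)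
          + (p : ℚ) ^ 5 * BbarSub p 1 4) := by
  obtain ⟨u, hu⟩ := exists_inv_sixty (p := p) (by lia)
  obtain ⟨a, e, hα⟩ := exists_newton_two_of_eleven_le h11
  obtain ⟨b, f, hβ⟩ := exists_newton_four_of_eleven_le h11
  obtain ⟨t, ht⟩ := exists_powerSum_expansion_six h11
  obtain ⟨q, hq⟩ := exists_powerSum_eq (p := p) 5
  have hα1 := hα 0 (by norm_num)
  have hβ1 := hβ 0 (by norm_num)
  have hα2 := hα 1 (by norm_num)
  have hβ2 := hβ 1 (by norm_num)
  have hα3 := hα 2 (by norm_num)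
  have hβ3 := hβ 2 (by norm_num)
  have hα4 := hα 3 (by norm_num)
  have hβ4 := hβ 3 (by norm_num)
  have hα5 := hα 4 (by norm_num)
  have hβ5 := hβ 4 (by norm_num)
  have hQ := ht 5
  norm_num only at hα1 hβ1 hα2 hβ2 hα3 hβ3 hα4 hβ4 hα5 hβ5
  simp only [Finset.sum_range_succ, Finset.sum_range_zero, momentMain, zero_add, Nat.reduceAdd,
    hα1, hβ1, hα2, hβ2, hα3, hβ3, hα4, hβ4, hα5, hβ5, hq] at hQ
  norm_num only [Nat.choose] at hQ
  obtain ⟨π, hπp⟩ : ∃ π : integralSubring p, (π : ℚ) = p := ⟨(p : integralSubring p), by simp⟩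
  refine congrMod_of_mul_eq (12 * u * π ^ 4 * q) (u ^ 2 * ((-21600 + 7200 * π) * a 2
          + (79200 - 72000 * π + 21600 * π ^ 2) * a 3
          + (-7200 + 7200 * π - 3600 * π ^ 2 + 720 * π ^ 3) * b 0
          + (79200 - 144000 * π + 129600 * π ^ 2 - 57600 * π ^ 3 + 10080 * π ^ 4) * b 1
          + (-25200 - 15000 * π - 3600 * π ^ 2 + 600 * π ^ 3) * e 1
          + (100800 - 19200 * π + 43200 * π ^ 2 - 9600 * π ^ 3) * e 2
          + (-151200 + 147600 * π - 129600 * π ^ 2 + 32400 * π ^ 3) * e 3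
          + (100800 - 177600 * π + 144000 * π ^ 2 - 38400 * π ^ 3) * e 4
          + (-25200 + 64200 * π - 54000 * π ^ 2 + 15000 * π ^ 3) * e 5
          + (-20160 + 4620 * π - 6750 * π ^ 2 + 2550 * π ^ 3 - 450 * π ^ 4 + 30 * π ^ 5) * f 1
          + (60480 - 125280 * π + 139200 * π ^ 2 - 74400 * π ^ 3 + 19200 * π ^ 4 - 1920 * π ^ 5) * f 2
          + (-151200 + 495720 * π - 634500 * π ^ 2 + 396900 * π ^ 3 - 121500 * π ^ 4 + 14580 * π ^ 5) * f 3
          + (201600 - 713280 * π + 993600 * π ^ 2 - 681600 * π ^ 3 + 230400 * π ^ 4 - 30720 * π ^ 5) * f 4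
          + (-90720 + 338220 * π - 498750 * π ^ 2 + 363750 * π ^ 3 - 131250 * π ^ 4 + 18750 * π ^ 5) * f 5
          + 3600 * t 1
          + (-7200) * t 2
          + 7200 * t 3
          + (-3600) * t 4
          + 720 * t 5)) ?_ ?_
  · rw [hq]
    push_cast [integralSubring_coe_ofNat]
    rw [hu, hπp]
    ring
  · simp only [hα1, hβ1, hα2, hβ2, hα3, hα4, hq]
    push_cast [integralSubring_coe_ofNat]
    rw [hu, hπp]
    linear_combination (1 / 5) * hQ

theorem congrMod_powerSum_six_of_eleven_le (h11 : 11 ≤ p) :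
      CongrMod p 6 (1 / 6 * (p : ℚ) ^ 5 * powerSum p 6)
        (-(Bbar p 6 - 5 * Bbar p 5 + 10 * Bbar p 4 - 10 * Bbar p 3 + 5 * Bbar p 2 - Bbar p 1)
          + (p : ℚ) ^ 2 * (10 / 3 * BbarSub p 1 2 - 10 * BbarSub p 2 2 + 10 * BbarSub p 3 2 - 10 / 3 * BbarSub p 4 2)
          + (p : ℚ) ^ 4 * (BbarSub p 1 4 - BbarSub p 2 4)) := by
  have h0 : (p : ℚ) ≠ 0 := by exact_mod_cast hp.out.ne_zero
  obtain ⟨u, hu⟩ := exists_inv_sixty (p := p) (by lia)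
  obtain ⟨a, e, hα⟩ := exists_newton_two_of_eleven_le h11
  obtain ⟨b, f, hβ⟩ := exists_newton_four_of_eleven_le h11
  obtain ⟨t, ht⟩ := exists_powerSum_expansion_six h11
  obtain ⟨q, hq⟩ := exists_powerSum_eq (p := p) 6
  have hα1 := hα 0 (by norm_num)
  have hβ1 := hβ 0 (by norm_num)
  have hα2 := hα 1 (by norm_num)
  have hβ2 := hβ 1 (by norm_num)
  have hα3 := hα 2 (by norm_num)
  have hβ3 := hβ 2 (by norm_num)
  have hα4 := hα 3 (by norm_num)
  have hβ4 := hβ 3 (by norm_num)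
  have hα5 := hα 4 (by norm_num)
  have hβ5 := hβ 4 (by norm_num)
  have hα6 := hα 5 (by norm_num)
  have hβ6 := hβ 5 (by norm_num)
  have hQ := ht 6
  norm_num only at hα1 hβ1 hα2 hβ2 hα3 hβ3 hα4 hβ4 hα5 hβ5 hα6 hβ6
  simp only [Finset.sum_range_succ, Finset.sum_range_zero, momentMain, zero_add, Nat.reduceAdd,
    hα1, hβ1, hα2, hβ2, hα3, hβ3, hα4, hβ4, hα5, hβ5, hα6, hβ6, hq] at hQ
  norm_num only [Nat.choose] at hQ
  obtain ⟨π, hπp⟩ : ∃ π : integralSubring p, (π : ℚ) = p := ⟨(p : integralSubring p), by simp⟩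
  -- The fifth difference of `Bbar` is divisible by p^5, which permits replacing p - 1 by -1 modulo
  -- p^6.
  obtain ⟨δ, hδ⟩ : ∃ δ : integralSubring p,
      Bbar p 6 - 5 * Bbar p 5 + 10 * Bbar p 4 - 10 * Bbar p 3 + 5 * Bbar p 2 - Bbar p 1 = (p : ℚ) ^ 5 * δ := by
    refine DivPow.exists_integralSubring 5 (DivPow.of_unit_mul (u := p - 1) ?_ ?_)
    · intro h
      have h1 : (p : ℤ) ∣ 1 := by simpa using (dvd_refl (p : ℤ)).sub h
      exact hp.out.one_lt.ne' (by exact_mod_cast Int.eq_one_of_dvd_one (by positivity) h1)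
    · set w : integralSubring p := 10 * u * q - u ^ 2 * ((-12000 + 36000 * π - 36000 * π ^ 2 + 12000 * π ^ 3) * a 3
          + (-3600 + 18000 * π - 36000 * π ^ 2 + 36000 * π ^ 3 - 18000 * π ^ 4 + 3600 * π ^ 5) * b 1
          + (3600 * π - 6600 * π ^ 2 + 3600 * π ^ 3 - 600 * π ^ 4) * e 1
          + (-36000 * π + 78000 * π ^ 2 - 54000 * π ^ 3 + 12000 * π ^ 4) * e 2
          + (120000 * π - 282000 * π ^ 2 + 216000 * π ^ 3 - 54000 * π ^ 4) * e 3
          + (-180000 * π + 444000 * π ^ 2 - 360000 * π ^ 3 + 96000 * π ^ 4) * e 4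
          + (126000 * π - 321000 * π ^ 2 + 270000 * π ^ 3 - 75000 * π ^ 4) * e 5
          + (-33600 * π + 87600 * π ^ 2 - 75600 * π ^ 3 + 21600 * π ^ 4) * e 6
          + (3600 * π - 8220 * π ^ 2 + 6750 * π ^ 3 - 2550 * π ^ 4 + 450 * π ^ 5 - 30 * π ^ 6) * f 1
          + (-54000 * π + 156600 * π ^ 2 - 174000 * π ^ 3 + 93000 * π ^ 4 - 24000 * π ^ 5 + 2400 * π ^ 6) * f 2
          + (252000 * π - 826200 * π ^ 2 + 1057500 * π ^ 3 - 661500 * π ^ 4 + 202500 * π ^ 5 - 24300 * π ^ 6) * f 3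
          + (-504000 * π + 1783200 * π ^ 2 - 2484000 * π ^ 3 + 1704000 * π ^ 4 - 576000 * π ^ 5 + 76800 * π ^ 6) * f 4
          + (453600 * π - 1691100 * π ^ 2 + 2493750 * π ^ 3 - 1818750 * π ^ 4 + 656250 * π ^ 5 - 93750 * π ^ 6) * f 5
          + (-151200 * π + 585720 * π ^ 2 - 900000 * π ^ 3 + 685800 * π ^ 4 - 259200 * π ^ 5 + 38880 * π ^ 6) * f 6
          + (-3600 * π) * t 1
          + (9000 * π) * t 2
          + (-12000 * π) * t 3
          + (9000 * π) * t 4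
          + (-3600 * π) * t 5
          + (600 * π) * t 6) with hw
      have hΔ : ((p - 1 : ℤ) : ℚ) * (Bbar p 6 - 5 * Bbar p 5 + 10 * Bbar p 4 - 10 * Bbar p 3 + 5 * Bbar p 2 - Bbar p 1) = p ^ 5 * w := by
        refine mul_left_cancel₀ h0 ?_
        rw [hw]
        push_cast [integralSubring_coe_ofNat]
        rw [hu, hπp]
        linear_combination (-1 / 6) * hQ
      rw [hΔ]
      exact DivPow.pow_mul 5 w.2
  refine congrMod_of_mul_eq (10 * u * π ^ 5 * q) (u ^ 2 * ((36000 - 36000 * π + 12000 * π ^ 2) * a 3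
          + (18000 - 36000 * π + 36000 * π ^ 2 - 18000 * π ^ 3 + 3600 * π ^ 4) * b 1
          + (-8400 - 6600 * π + 3600 * π ^ 2 - 600 * π ^ 3) * e 1
          + (84000 - 282000 * π + 216000 * π ^ 2 - 54000 * π ^ 3) * e 3
          + (-168000 + 444000 * π - 360000 * π ^ 2 + 96000 * π ^ 3) * e 4
          + (126000 - 321000 * π + 270000 * π ^ 2 - 75000 * π ^ 3) * e 5
          + (-33600 + 87600 * π - 75600 * π ^ 2 + 21600 * π ^ 3) * e 6
          + (-50400 + 156600 * π - 174000 * π ^ 2 + 93000 * π ^ 3 - 24000 * π ^ 4 + 2400 * π ^ 5) * f 2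
          + (252000 - 826200 * π + 1057500 * π ^ 2 - 661500 * π ^ 3 + 202500 * π ^ 4 - 24300 * π ^ 5) * f 3
          + (-504000 + 1783200 * π - 2484000 * π ^ 2 + 1704000 * π ^ 3 - 576000 * π ^ 4 + 76800 * π ^ 5) * f 4
          + (453600 - 1691100 * π + 2493750 * π ^ 2 - 1818750 * π ^ 3 + 656250 * π ^ 4 - 93750 * π ^ 5) * f 5
          + (-151200 + 585720 * π - 900000 * π ^ 2 + 685800 * π ^ 3 - 259200 * π ^ 4 + 38880 * π ^ 5) * f 6
          + (-3600) * t 1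
          + 9000 * t 2
          + (-12000) * t 3
          + 9000 * t 4
          + (-3600) * t 5
          + 600 * t 6
          + (78000 * π - 54000 * π ^ 2 + 12000 * π ^ 3) * e 2
          + (-8220 * π + 6750 * π ^ 2 - 2550 * π ^ 3 + 450 * π ^ 4 - 30 * π ^ 5) * f 1) + δ) ?_ ?_
  · rw [hq]
    push_cast [integralSubring_coe_ofNat]
    rw [hu, hπp]
    ring
  · simp only [hα1, hβ1, hα2, hβ2, hα3, hα4, hq]
    push_cast [integralSubring_coe_ofNat]
    rw [hu, hπp]
    linear_combination (1 / 6) * hQ + p ^ 2 * hδ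

end Congruences
end FermatQuot

open FermatQuot in
theorem theorem1p3 (p : ℕ) (hp : p.Prime) :
    (7 ≤ p →
      CongrMod p 5 (powerSum p 1)
        (((p : ℚ) - 1) * Bbar p 1
          - (p : ℚ) ^ 2 * BbarSub p 1 2
          + 11 / 6 * (p : ℚ) ^ 3 * BbarSub p 1 2
          - (p : ℚ) ^ 4 * (BbarSub p 1 2 + BbarSub p 1 4)) ∧
      CongrMod p 5 (1 / 2 * (p : ℚ) * powerSum p 2)
        (((p : ℚ) - 1) * (Bbar p 2 - Bbar p 1)
          + (p : ℚ) ^ 2 * (BbarSub p 1 2 - 2 * BbarSub p 2 2)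
          + (p : ℚ) ^ 3 * (-11 / 6 * BbarSub p 1 2 + 13 / 3 * BbarSub p 2 2)
          - (p : ℚ) ^ 4 * (2 * BbarSub p 1 2 + 2 * BbarSub p 1 4)) ∧
      CongrMod p 5 (1 / 3 * (p : ℚ) ^ 2 * powerSum p 3)
        (((p : ℚ) - 1) * (Bbar p 3 - 2 * Bbar p 2 + Bbar p 1)
          + (p : ℚ) ^ 2 * (-BbarSub p 1 2 + 4 * BbarSub p 2 2 - 10 / 3 * BbarSub p 3 2)
          + (p : ℚ) ^ 3 * (-6 * BbarSub p 1 2 + 7 * BbarSub p 2 2)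
          - (p : ℚ) ^ 4 * (BbarSub p 1 2 + 2 * BbarSub p 1 4)) ∧
      CongrMod p 5 (1 / 4 * (p : ℚ) ^ 3 * powerSum p 4)
        (((p : ℚ) - 1) * (Bbar p 4 - 3 * Bbar p 3 + 3 * Bbar p 2 - Bbar p 1)
          + (p : ℚ) ^ 2 * (-4 * BbarSub p 1 2 + 9 * BbarSub p 2 2 - 5 * BbarSub p 3 2)
          + (p : ℚ) ^ 3 * (-3 * BbarSub p 1 2 + 3 * BbarSub p 2 2)
          - (p : ℚ) ^ 4 * BbarSub p 1 4) ∧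
      CongrMod p 5 (1 / 5 * (p : ℚ) ^ 4 * powerSum p 5)
        (-(Bbar p 5 - 4 * Bbar p 4 + 6 * Bbar p 3 - 4 * Bbar p 2 + Bbar p 1)
          + (p : ℚ) ^ 2 * (-2 * BbarSub p 1 2 + 4 * BbarSub p 2 2 - 2 * BbarSub p 3 2)
          - 1 / 5 * (p : ℚ) ^ 4 * BbarSub p 1 4)) ∧
    (11 ≤ p →
      CongrMod p 6 (powerSum p 1)
        (((p : ℚ) - 1) * Bbar p 1
          - (p : ℚ) ^ 2 * BbarSub p 1 2
          + 11 / 6 * (p : ℚ) ^ 3 * BbarSub p 1 2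
          - (p : ℚ) ^ 4 * (BbarSub p 1 2 + BbarSub p 1 4)
          + (p : ℚ) ^ 5 * (1 / 6 * BbarSub p 1 2 + 137 / 60 * BbarSub p 1 4)) ∧
      CongrMod p 6 (1 / 2 * (p : ℚ) * powerSum p 2)
        (((p : ℚ) - 1) * (Bbar p 2 - Bbar p 1)
          + (p : ℚ) ^ 2 * (BbarSub p 1 2 - 2 * BbarSub p 2 2)
          + (p : ℚ) ^ 3 * (-11 / 6 * BbarSub p 1 2 + 13 / 3 * BbarSub p 2 2)
          + (p : ℚ) ^ 4 * (BbarSub p 1 2 - 3 * BbarSub p 2 2 + BbarSub p 1 4 - 3 * BbarSub p 2 4)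
          + (p : ℚ) ^ 5 * (1 / 2 * BbarSub p 1 2 + 77 / 12 * BbarSub p 1 4)) ∧
      CongrMod p 6 (1 / 3 * (p : ℚ) ^ 2 * powerSum p 3)
        (((p : ℚ) - 1) * (Bbar p 3 - 2 * Bbar p 2 + Bbar p 1)
          + (p : ℚ) ^ 2 * (-BbarSub p 1 2 + 4 * BbarSub p 2 2 - 10 / 3 * BbarSub p 3 2)
          + (p : ℚ) ^ 3 * (11 / 6 * BbarSub p 1 2 - 26 / 3 * BbarSub p 2 2 + 47 / 6 * BbarSub p 3 2)
          + (p : ℚ) ^ 4 * (5 * BbarSub p 1 2 - 6 * BbarSub p 2 2 + 6 * BbarSub p 1 4 - 8 * BbarSub p 2 4)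
          + (p : ℚ) ^ 5 * (1 / 3 * BbarSub p 1 2 + 47 / 6 * BbarSub p 1 4)) ∧
      CongrMod p 6 (1 / 4 * (p : ℚ) ^ 3 * powerSum p 4)
        (((p : ℚ) - 1) * (Bbar p 4 - 3 * Bbar p 3 + 3 * Bbar p 2 - Bbar p 1)
          + (p : ℚ) ^ 2 * (BbarSub p 1 2 - 6 * BbarSub p 2 2 + 10 * BbarSub p 3 2 - 5 * BbarSub p 4 2)
          + (p : ℚ) ^ 3 * (21 / 2 * BbarSub p 1 2 - 24 * BbarSub p 2 2 + 27 / 2 * BbarSub p 3 2)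
          + (p : ℚ) ^ 4 * (3 * BbarSub p 1 2 - 3 * BbarSub p 2 2 + 8 * BbarSub p 1 4 - 9 * BbarSub p 2 4)
          + 9 / 2 * (p : ℚ) ^ 5 * BbarSub p 1 4) ∧
      CongrMod p 6 (1 / 5 * (p : ℚ) ^ 4 * powerSum p 5)
        (((p : ℚ) - 1) * (Bbar p 5 - 4 * Bbar p 4 + 6 * Bbar p 3 - 4 * Bbar p 2 + Bbar p 1)
          + (p : ℚ) ^ 2 * (6 * BbarSub p 1 2 - 20 * BbarSub p 2 2 + 22 * BbarSub p 3 2 - 8 * BbarSub p 4 2)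
          + (p : ℚ) ^ 3 * (6 * BbarSub p 1 2 - 12 * BbarSub p 2 2 + 6 * BbarSub p 3 2)
          + (p : ℚ) ^ 4 * (23 / 5 * BbarSub p 1 4 - 24 / 5 * BbarSub p 2 4)
          + (p : ℚ) ^ 5 * BbarSub p 1 4) ∧
      CongrMod p 6 (1 / 6 * (p : ℚ) ^ 5 * powerSum p 6)
        (-(Bbar p 6 - 5 * Bbar p 5 + 10 * Bbar p 4 - 10 * Bbar p 3 + 5 * Bbar p 2 - Bbar p 1)
          + (p : ℚ) ^ 2 * (10 / 3 * BbarSub p 1 2 - 10 * BbarSub p 2 2 + 10 * BbarSub p 3 2 - 10 / 3 * BbarSub p 4 2)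
          + (p : ℚ) ^ 4 * (BbarSub p 1 4 - BbarSub p 2 4))) := by
  have : Fact p.Prime := ⟨hp⟩
  exact ⟨fun h => ⟨congrMod_powerSum_one_of_seven_le h,
      congrMod_powerSum_two_of_seven_le h,
      congrMod_powerSum_three_of_seven_le h,
      congrMod_powerSum_four_of_seven_le h,
      congrMod_powerSum_five_of_seven_le h⟩,
    fun h => ⟨congrMod_powerSum_one_of_eleven_le h,
      congrMod_powerSum_two_of_eleven_le h,
      congrMod_powerSum_three_of_eleven_le h,
      congrMod_powerSum_four_of_eleven_le h,
      congrMod_powerSum_five_of_eleven_le h,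
      congrMod_powerSum_six_of_eleven_le h⟩⟩
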